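/- Let $G$ be a countable discrete group, let $(X,\mu)$ be a probability space, and let $G\curvearrowright (X,\mu)$ be an ergodic probability measure preserving (p.m.p.) action. Let $H$ be a subgroup of $G$ which is strongly relatively ICC in $G$, i.e. the set $\{hgh^{-1} : h\in H\}$ is infinite for every $g\in G\setminus\{e\}$, and assume that $H$ acts trivially on $X$, i.e. for every $h\in H$ one has $hx=x$ for $\mu$-almost every $x\in X$. Let $L^\infty(X)\rtimes G$ be the crossed product von Neumann algebra, that is, the von Neumann algebra on $L^2(X,\mu)\otimes\ell^2(G)$ generated by the multiplication operators $f\otimes 1$, $f\in L^\infty(X,\mu)$, and the canonical unitaries $u_g=\sigma_g\otimes\lambda_g$, $g\in G$ (where $\sigma$ is the Koopman representation and $\lambda$ the left regular representation), and let $L(G)$ be its von Neumann subalgebra generated by $\{u_g : g\in G\}$. Then for every von Neumann algebra $\mathsf P$ with $L(G)\subseteq \mathsf P\subseteq L^\infty(X)\rtimes G$ there is a $G$-factor $Y$ of $X$, i.e. a p.m.p. action of $G$ on a probability space $(Y,\nu)$ with a $G$-equivariant measure preserving map $\pi:X\to Y$, such that $\mathsf P=L^\infty(Y)\rtimes G$,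 where $L^\infty(Y)\rtimes G$ is viewed as the von Neumann subalgebra of $L^\infty(X)\rtimes G$ generated by $\{(f\circ\pi)\otimes 1 : f\in L^\infty(Y,\nu)\}$ and $\{u_g : g\in G\}$. Moreover, if $X$ is a standard Borel space, then $Y$ can be chosen to be a standard Borel space. -/

import Mathlib

open MeasureTheory
open scoped ENNReal

universe u v

namespace IntermediateCrossedProduct

section HilbertSpace

variable {G : Type v} {E : Type u} [NormedAddCommGroup E] [InnerProductSpace ℂ E]

theorem memlp_comp (e : G ≃ G) (T : E →L[ℂ] E) (ξ : lp (fun _ : G => E) 2) :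
    Memℓp (fun g => T (ξ (e g))) 2 := by
  have h2 : (0 : ℝ) < (2 : ℝ≥0∞).toReal := by norm_num
  apply memℓp_gen
  have hs : Summable fun g => ‖ξ g‖ ^ (2 : ℝ≥0∞).toReal := (lp.memℓp ξ).summable h2
  have hs' : Summable fun g => ‖ξ (e g)‖ ^ (2 : ℝ≥0∞).toReal := e.summable_iff.mpr hs
  refine Summable.of_nonneg_of_le (fun g => by positivity) (fun g => ?_)
    (hs'.mul_left (‖T‖ ^ (2 : ℝ≥0∞).toReal))
  rw [← Real.mul_rpow (norm_nonneg _) (norm_nonneg _)]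
  exact Real.rpow_le_rpow (norm_nonneg _) (T.le_opNorm _) h2.le

/-- The bounded operator `ξ ↦ (g ↦ T (ξ (e g)))` on the Hilbert space `ℓ²(G, E)`, for a bijection
`e` of `G` and a bounded operator `T` on `E`. -/
noncomputable def compOp (e : G ≃ G) (T : E →L[ℂ] E) :
    lp (fun _ : G => E) 2 →L[ℂ] lp (fun _ : G => E) 2 :=
  LinearMap.mkContinuous
    { toFun := fun ξ => ⟨fun g => T (ξ (e g)), memlp_comp e T ξ⟩
      map_add' := fun ξ η => by ext1; funext g; exact map_add T (ξ (e g)) (η (e g))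
      map_smul' := fun c ξ => by ext1; funext g; exact map_smul T c (ξ (e g)) }
    ‖T‖ (by
      intro ξ
      have h2 : (0 : ℝ) < (2 : ℝ≥0∞).toReal := by norm_num
      refine lp.norm_le_of_forall_sum_le h2 (by positivity) (fun s => ?_)
      rw [Real.mul_rpow (norm_nonneg _) (norm_nonneg _), lp.norm_rpow_eq_tsum h2 ξ]
      have hs : Summable fun g => ‖ξ g‖ ^ (2 : ℝ≥0∞).toReal := (lp.memℓp ξ).summable h2
      have hs' : Summable fun g => ‖ξ (e g)‖ ^ (2 : ℝ≥0∞).toReal := e.summable_iff.mpr hs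
      calc ∑ g ∈ s, ‖T (ξ (e g))‖ ^ (2 : ℝ≥0∞).toReal
          ≤ ∑ g ∈ s, ‖T‖ ^ (2 : ℝ≥0∞).toReal * ‖ξ (e g)‖ ^ (2 : ℝ≥0∞).toReal := by
            refine Finset.sum_le_sum fun g _ => ?_
            rw [← Real.mul_rpow (norm_nonneg _) (norm_nonneg _)]
            exact Real.rpow_le_rpow (norm_nonneg _) (T.le_opNorm _) h2.le
        _ = ‖T‖ ^ (2 : ℝ≥0∞).toReal * ∑ g ∈ s, ‖ξ (e g)‖ ^ (2 : ℝ≥0∞).toReal := by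
            rw [Finset.mul_sum]
        _ ≤ ‖T‖ ^ (2 : ℝ≥0∞).toReal * ∑' g, ‖ξ g‖ ^ (2 : ℝ≥0∞).toReal := by
            refine mul_le_mul_of_nonneg_left ?_ (by positivity)
            rw [← e.tsum_eq (fun g => ‖ξ g‖ ^ (2 : ℝ≥0∞).toReal)]
            exact hs'.sum_le_tsum s (fun g _ => by positivity))

@[simp]
theorem compOp_apply (e : G ≃ G) (T : E →L[ℂ] E) (ξ : lp (fun _ : G => E) 2) (g : G) :
    compOp e T ξ g = T (ξ (e g)) := rfl

end HilbertSpace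

/-- The von Neumann algebra generated by a set `S` of bounded operators on a Hilbert space: the
bicommutant of the self-adjoint set `S ∪ S*`.
(`StarSubalgebra.centralizer ℂ S` is the commutant of `S ∪ S*`.) -/
noncomputable def vonNeumannClosure {K : Type u} [NormedAddCommGroup K] [InnerProductSpace ℂ K]
    [CompleteSpace K] (S : Set (K →L[ℂ] K)) : VonNeumannAlgebra K where
  toStarSubalgebra :=
    StarSubalgebra.centralizer ℂ (StarSubalgebra.centralizer ℂ S : Set (K →L[ℂ] K))
  centralizer_centralizer' := by simp

section Action

variable (G : Type v) [Group G] {X : Type u} [MeasurableSpace X]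

/-- The Hilbert space `ℓ²(G, L²(X, μ)) = L²(X, μ) ⊗ ℓ²(G)`. -/
abbrev CrossedSpace (μ : Measure X) : Type (max u v) :=
  lp (fun _ : G => Lp ℂ 2 μ) 2

/-- The action of `f ∈ L^∞(X, μ)` on `ℓ²(G, L²(X, μ))` as the operator `M_f ⊗ 1`, that is,
`(f ξ)(g) = f · ξ(g)`. -/
noncomputable def mulOp {μ : Measure X} (f : Lp ℂ ∞ μ) :
    CrossedSpace G μ →L[ℂ] CrossedSpace G μ :=
  compOp (Equiv.refl G) ((ContinuousLinearMap.mul ℂ ℂ).holderL μ ∞ 2 2 f)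

variable {G} [MulAction G X] [MeasurableConstSMul G X]

/-- The canonical unitary `u_s = σ_s ⊗ λ_s` on `ℓ²(G, L²(X, μ))`, where `σ` is the Koopman
representation `(σ_s ζ)(x) = ζ(s⁻¹ x)` and `λ` the left regular representation; that is,
`(u_s ξ)(g) = σ_s (ξ(s⁻¹ g))`. -/
noncomputable def unitaryOp (μ : Measure X) [SMulInvariantMeasure G X μ] (s : G) :
    CrossedSpace G μ →L[ℂ] CrossedSpace G μ :=
  compOp (Equiv.mulLeft s⁻¹)
    (Lp.compMeasurePreservingₗᵢ ℂ (fun x : X => s⁻¹ • x)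
      (measurePreserving_smul s⁻¹ μ)).toContinuousLinearMap

variable (G)

/-- `L(G)`, as a von Neumann subalgebra of `L^∞(X) ⋊ G`: it is generated by the canonical
unitaries. -/
noncomputable def groupAlgebra (μ : Measure X) [SMulInvariantMeasure G X μ] :
    VonNeumannAlgebra (CrossedSpace G μ) :=
  vonNeumannClosure (Set.range (unitaryOp (G := G) μ))

/-- The crossed product von Neumann algebra `L^∞(X, μ) ⋊ G`, generated by `L^∞(X, μ)` and the
canonical unitaries. -/
noncomputable def crossedProduct (μ : Measure X) [SMulInvariantMeasure G X μ] :
    VonNeumannAlgebra (CrossedSpace G μ) :=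
  vonNeumannClosure
    (Set.range (mulOp G : Lp ℂ ∞ μ → _) ∪ Set.range (unitaryOp (G := G) μ))

/-- A `G`-factor of the p.m.p. action of `G` on `(X, μ)`: a p.m.p. action of `G` on a probability
space `(Y, ν)` together with a `G`-equivariant measure preserving map `π : X → Y`. -/
structure GFactor (μ : Measure X) where
  /-- The underlying set of the factor. -/
  Y : Type u
  [measurableSpace : MeasurableSpace Y]
  [mulAction : MulAction G Y]
  [measurableConstSMul : MeasurableConstSMul G Y]
  /-- The measure of the factor. -/
  ν : Measure Y
  [isProbabilityMeasure : IsProbabilityMeasure ν]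
  [smulInvariantMeasure : SMulInvariantMeasure G Y ν]
  /-- The factor map. -/
  π : X → Y
  measurePreserving : MeasurePreserving π μ ν
  equivariant : ∀ (g : G) (x : X), π (g • x) = g • π x

attribute [instance] GFactor.measurableSpace GFactor.mulAction GFactor.measurableConstSMul
  GFactor.isProbabilityMeasure GFactor.smulInvariantMeasure

variable {G}

/-- For a `G`-factor `π : X → Y`, the subalgebra `L^∞(Y) ⋊ G` of `L^∞(X) ⋊ G`: it is generated by
the functions `f ∘ π` with `f ∈ L^∞(Y, ν)` and the canonical unitaries. -/
noncomputable def GFactor.crossedProduct {μ : Measure X} [SMulInvariantMeasure G X μ]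
    (F : GFactor G μ) : VonNeumannAlgebra (CrossedSpace G μ) :=
  vonNeumannClosure
    (Set.range (fun f : Lp ℂ ∞ F.ν => mulOp G (Lp.compMeasurePreserving F.π F.measurePreserving f))
      ∪ Set.range (unitaryOp (G := G) μ))

end Action

/-- A subgroup `H` of `G` is strongly relatively ICC in `G` if `{h g h⁻¹ : h ∈ H}` is infinite for
every `g ≠ 1` in `G`. -/
def IsStronglyRelativelyICC {G : Type v} [Group G] (H : Subgroup G) : Prop :=
  ∀ g : G, g ≠ 1 → {k : G | ∃ h ∈ H, k = h * g * h⁻¹}.Infinite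

end IntermediateCrossedProduct

namespace IntermediateCrossedProduct

/-! Write `M` for the crossed product, `Ω = 1 ⊗ δ_e` for the trace vector and `L²(P)` for the
closure of `PΩ`. Right multiplications commute with `M`, and `x*Ω = J(xΩ)` for `x ∈ M`. These facts
show that an `x ∈ M` belongs to `P` as soon as `xΩ ∈ L²(P)` (`mem_of_apply_traceVector_mem`).

Since `h ∈ H` acts trivially on `X`, conjugation by `u_h` only permutes the coordinates of `ℓ²(G,
L²(X))`, by `k ↦ h⁻¹kh`. It preserves `L²(P)` and fixes `ψ ⊗ δ_e`, so the projection of `ψ ⊗ δ_e` to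
`L²(P)` is constant on `H`-conjugacy orbits. These are infinite off `e`, so square summability
leaves only the coordinate at `e` (`starProjection_sgl_apply_ne`). Consequently `L²(P)` contains
each coordinate of each of its vectors (`sgl_mem_traceSpace`) and is determined by its part
`baseSpace P` inside `L²(X)`.

That part consists of the `L²` functions measurable for a `G`-invariant σ-algebra: if `a ∈ baseSpace
P`, the indicators of the discs `{|a - c| ≤ t}` lie in `P` (`mulOp_sublevel_mem`), by a norm
estimate against the commutant that avoids unbounded operators. The σ-algebra is realised by the
point map recording which sets of an invariant family contain `x`. When `X` is standard, a countable
family suffices. -/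

open scoped InnerProductSpace

set_option linter.unusedSectionVars false

/-! ### Bounded multiplication operators on `L²(X)`. -/

section SquareIntegrable

variable {X : Type u} [MeasurableSpace X] {μ : Measure X}

/-- Multiplication by an essentially bounded function on `L²`. -/
noncomputable def mulL (f : Lp ℂ ∞ μ) : Lp ℂ 2 μ →L[ℂ] Lp ℂ 2 μ :=
  (ContinuousLinearMap.mul ℂ ℂ).holderL μ ∞ 2 2 f

theorem coeFn_mulL (f : Lp ℂ ∞ μ) (ψ : Lp ℂ 2 μ) : mulL f ψ =ᵐ[μ] fun x => f x * ψ x :=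
  (ContinuousLinearMap.mul ℂ ℂ).coeFn_holder f ψ

theorem norm_mulL_le (f : Lp ℂ ∞ μ) : ‖mulL f‖ ≤ ‖f‖ := by
  refine ContinuousLinearMap.opNorm_le_bound _ (norm_nonneg _) fun ψ => ?_
  refine ((ContinuousLinearMap.mul ℂ ℂ).norm_holder_apply_apply_le f ψ).trans ?_
  gcongr
  simp

theorem inner_mulL_left (f : Lp ℂ ∞ μ) (ψ φ : Lp ℂ 2 μ) :
    ⟪mulL f ψ, φ⟫_ℂ = ⟪ψ, mulL (star f) φ⟫_ℂ := by
  rw [L2.inner_def, L2.inner_def]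
  refine integral_congr_ae ?_
  filter_upwards [coeFn_mulL f ψ, coeFn_mulL (star f) φ, Lp.coeFn_star f] with x h1 h2 h3
  simp only [h1, h2, h3, RCLike.inner_apply, Pi.star_apply, RCLike.star_def, map_mul]
  ring

theorem mulL_comm (f h : Lp ℂ ∞ μ) (ψ : Lp ℂ 2 μ) : mulL f (mulL h ψ) = mulL h (mulL f ψ) := by
  apply Lp.ext
  filter_upwards [coeFn_mulL f (mulL h ψ), coeFn_mulL h ψ, coeFn_mulL h (mulL f ψ), coeFn_mulL f ψ]
    with x h1 h2 h3 h4
  rw [h1, h2, h3, h4]; ring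

/-- Together with the next instance, this supplies a continuous pointwise `star` on `ℓ²(G, L²(X))`,
from which `conjOp` is built. -/
noncomputable instance : StarAddMonoid (Lp ℂ 2 μ) where
  star_add f h := by
    apply Lp.ext
    filter_upwards [Lp.coeFn_star (f + h), Lp.coeFn_add f h, Lp.coeFn_add (star f) (star h),
      Lp.coeFn_star f, Lp.coeFn_star h] with x h1 h2 h3 h4 h5
    rw [h1, h3, Pi.star_apply, h2, Pi.add_apply, Pi.add_apply, h4, h5, star_add]
    rfl

instance : NormedStarGroup (Lp ℂ 2 μ) where
  norm_star_le f := by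
    refine Lp.norm_le_norm_of_ae_le ?_
    filter_upwards [Lp.coeFn_star f] with x h1
    simp [h1]

variable [IsProbabilityMeasure μ]

variable (μ) in
/-- The constant function one in `L²`. -/
noncomputable def oneL : Lp ℂ 2 μ := Lp.const 2 μ (1 : ℂ)

theorem coeFn_oneL : oneL μ =ᵐ[μ] fun _ => (1 : ℂ) := Lp.coeFn_const 2 μ 1

theorem coeFn_mulL_oneL (f : Lp ℂ ∞ μ) : mulL f (oneL μ) =ᵐ[μ] f := by
  filter_upwards [coeFn_mulL f (oneL μ), coeFn_oneL (μ := μ)] with x h1 h2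
  simp [h1, h2]

/-- The indicator function of a measurable set in `L^∞`. -/
noncomputable def indTop {E : Set X} (hE : MeasurableSet E) : Lp ℂ ∞ μ :=
  indicatorConstLp ∞ hE (measure_ne_top μ E) 1

theorem coeFn_indTop {E : Set X} (hE : MeasurableSet E) :
    (indTop hE : Lp ℂ ∞ μ) =ᵐ[μ] E.indicator fun _ => (1 : ℂ) :=
  indicatorConstLp_coeFn

theorem mulL_indTop_oneL {E : Set X} (hE : MeasurableSet E) :
    mulL (indTop hE) (oneL μ) = indicatorConstLp 2 hE (measure_ne_top μ E) 1 := by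
  apply Lp.ext
  filter_upwards [coeFn_mulL_oneL (μ := μ) (indTop hE), coeFn_indTop (μ := μ) hE,
    indicatorConstLp_coeFn (p := 2) (hs := hE) (hμs := measure_ne_top μ E) (c := (1 : ℂ))]
    with x h1 h2 h3
  rw [h1, h2, h3]

/-- Testing against indicators already makes every set integral of `ψ` vanish. -/
theorem eq_zero_of_forall_inner_mulL_oneL {ψ : Lp ℂ 2 μ}
    (h : ∀ f : Lp ℂ ∞ μ, ⟪ψ, mulL f (oneL μ)⟫_ℂ = 0) : ψ = 0 := by
  rw [Lp.eq_zero_iff_ae_eq_zero]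
  refine Lp.ae_eq_zero_of_forall_setIntegral_eq_zero ψ two_ne_zero ENNReal.ofNat_ne_top
    (fun s _ _ => ((Lp.memLp ψ).integrable one_le_two).integrableOn) fun s hs _ => ?_
  rw [← L2.inner_indicatorConstLp_one (𝕜 := ℂ) hs (measure_ne_top μ s) ψ, ← mulL_indTop_oneL,
    ← inner_conj_symm, h, map_zero]

end SquareIntegrable

/-! ### The Koopman representation. -/

section Koopman

variable {G : Type v} [Group G] {X : Type u} [MeasurableSpace X] [MulAction G X]
  [MeasurableConstSMul G X] (μ : Measure X) [SMulInvariantMeasure G X μ]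

/-- The Koopman representation on `L^p`: `(σ_s f)(x) = f (s⁻¹ x)`. -/
noncomputable def koopman (p : ℝ≥0∞) (s : G) (f : Lp ℂ p μ) : Lp ℂ p μ :=
  Lp.compMeasurePreserving (fun x : X => s⁻¹ • x) (measurePreserving_smul s⁻¹ μ) f

variable {μ}

theorem coeFn_koopman {p : ℝ≥0∞} (s : G) (f : Lp ℂ p μ) :
    koopman μ p s f =ᵐ[μ] fun x => f (s⁻¹ • x) :=
  Lp.coeFn_compMeasurePreserving f _

theorem ae_smul {q : X → Prop} (s : G) (h : ∀ᵐ x ∂μ, q x) : ∀ᵐ x ∂μ, q (s • x) :=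
  (measurePreserving_smul s μ).quasiMeasurePreserving.ae h

theorem koopman_one {p : ℝ≥0∞} (f : Lp ℂ p μ) : koopman μ p (1 : G) f = f := by
  apply Lp.ext
  filter_upwards [coeFn_koopman (1 : G) f] with x h1
  simp [h1]

theorem koopman_mul {p : ℝ≥0∞} (s t : G) (f : Lp ℂ p μ) :
    koopman μ p (s * t) f = koopman μ p s (koopman μ p t f) := by
  apply Lp.ext
  filter_upwards [coeFn_koopman (s * t) f, coeFn_koopman s (koopman μ p t f),
    ae_smul s⁻¹ (coeFn_koopman t f)] with x h1 h2 h3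
  rw [h1, h2, h3, mul_inv_rev, mul_smul]

theorem norm_koopman {p : ℝ≥0∞} (s : G) (f : Lp ℂ p μ) : ‖koopman μ p s f‖ = ‖f‖ :=
  Lp.norm_compMeasurePreserving f _

theorem koopman_mulL (s : G) (f : Lp ℂ ∞ μ) (ψ : Lp ℂ 2 μ) :
    koopman μ 2 s (mulL f ψ) = mulL (koopman μ ∞ s f) (koopman μ 2 s ψ) := by
  apply Lp.ext
  filter_upwards [coeFn_koopman s (mulL f ψ), ae_smul s⁻¹ (coeFn_mulL f ψ),
    coeFn_mulL (koopman μ ∞ s f) (koopman μ 2 s ψ), coeFn_koopman s f, coeFn_koopman s ψ]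
    with x h1 h2 h3 h4 h5
  rw [h1, h2, h3, h4, h5]

theorem koopman_eq_self {p : ℝ≥0∞} {s : G} (hs : ∀ᵐ x ∂μ, s⁻¹ • x = x) (f : Lp ℂ p μ) :
    koopman μ p s f = f := by
  apply Lp.ext
  filter_upwards [coeFn_koopman s f, hs] with x h1 h2
  rw [h1, h2]

theorem koopman_oneL [IsProbabilityMeasure μ] (s : G) : koopman μ 2 s (oneL μ) = oneL μ := by
  apply Lp.ext
  filter_upwards [coeFn_koopman s (oneL μ), ae_smul s⁻¹ (coeFn_oneL (μ := μ)),
    coeFn_oneL (μ := μ)] with x h1 h2 h3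
  rw [h1, h2, h3]

variable (μ) in
/-- The Koopman representation on `L²` as linear isometries. -/
noncomputable def koopmanIso (s : G) : Lp ℂ 2 μ →ₗᵢ[ℂ] Lp ℂ 2 μ :=
  Lp.compMeasurePreservingₗᵢ ℂ (fun x : X => s⁻¹ • x) (measurePreserving_smul s⁻¹ μ)

@[simp]
theorem koopmanIso_apply (s : G) (ψ : Lp ℂ 2 μ) : koopmanIso μ s ψ = koopman μ 2 s ψ := rfl

theorem inner_koopman (s : G) (ψ φ : Lp ℂ 2 μ) :
    ⟪koopman μ 2 s ψ, koopman μ 2 s φ⟫_ℂ = ⟪ψ, φ⟫_ℂ :=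
  (koopmanIso μ s).inner_map_map ψ φ

theorem inner_koopman_left (s : G) (ψ φ : Lp ℂ 2 μ) :
    ⟪koopman μ 2 s ψ, φ⟫_ℂ = ⟪ψ, koopman μ 2 s⁻¹ φ⟫_ℂ := by
  rw [← inner_koopman s ψ, ← koopman_mul, mul_inv_cancel, koopman_one]

end Koopman

/-! ### Operators on `ℓ²(G, E)` acting coordinatewise up to a permutation. -/

section DiagonalOperator

variable {G : Type v} {E : Type u} [NormedAddCommGroup E] [InnerProductSpace ℂ E]

omit [InnerProductSpace ℂ E] in
theorem lp_norm_sq (ξ : lp (fun _ : G => E) 2) : ‖ξ‖ ^ 2 = ∑' g, ‖ξ g‖ ^ 2 := by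
  have := lp.norm_rpow_eq_tsum (p := 2) (by norm_num) ξ
  simpa using this

omit [InnerProductSpace ℂ E] in
theorem lp_summable_norm_sq (ξ : lp (fun _ : G => E) 2) : Summable fun g => ‖ξ g‖ ^ 2 := by
  have := (lp.memℓp ξ).summable (p := 2) (by norm_num)
  simpa using this

theorem memlp_diag (e : G ≃ G) (T : G → E →L[ℂ] E) (C : ℝ) (hT : ∀ g, ‖T g‖ ≤ C)
    (ξ : lp (fun _ : G => E) 2) : Memℓp (fun g => T g (ξ (e g))) 2 := by
  apply memℓp_gen
  have hs := ((e.summable_iff.mpr (lp_summable_norm_sq ξ)).mul_left (C ^ 2))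
  refine Summable.of_nonneg_of_le (fun g => by positivity) (fun g => ?_) hs
  simp only [ENNReal.toReal_ofNat, Real.rpow_two, Function.comp_apply, ← mul_pow]
  gcongr
  exact (T g).le_of_opNorm_le (hT g) _

omit [InnerProductSpace ℂ E] in
theorem lp_norm_le_of_forall (e : G ≃ G) (C : ℝ) (ξ η : lp (fun _ : G => E) 2)
    (h : ∀ g, ‖η g‖ ≤ C * ‖ξ (e g)‖) : ‖η‖ ≤ |C| * ‖ξ‖ := by
  have hs : Summable fun g => C ^ 2 * ‖ξ (e g)‖ ^ 2 :=
    (e.summable_iff.mpr (lp_summable_norm_sq ξ)).mul_left (C ^ 2)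
  have key : ‖η‖ ^ 2 ≤ (|C| * ‖ξ‖) ^ 2 := by
    rw [mul_pow, sq_abs, lp_norm_sq, lp_norm_sq, ← e.tsum_eq (fun g => ‖ξ g‖ ^ 2), ← tsum_mul_left]
    refine Summable.tsum_le_tsum (fun g => ?_) (lp_summable_norm_sq η) hs
    rw [← mul_pow]
    exact pow_le_pow_left₀ (norm_nonneg _) (h g) 2
  exact le_of_sq_le_sq key (by positivity)

/-- The bounded operator `ξ ↦ (g ↦ T g (ξ (e g)))` on `ℓ²(G, E)`, for a bijection `e` of `G` and a
uniformly bounded family of bounded operators `T g` on `E`. -/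
noncomputable def diagOp (e : G ≃ G) (T : G → E →L[ℂ] E) (C : ℝ) (hT : ∀ g, ‖T g‖ ≤ C) :
    lp (fun _ : G => E) 2 →L[ℂ] lp (fun _ : G => E) 2 :=
  LinearMap.mkContinuous
    { toFun := fun ξ => ⟨fun g => T g (ξ (e g)), memlp_diag e T C hT ξ⟩
      map_add' := fun ξ η => by ext1; funext g; exact map_add (T g) (ξ (e g)) (η (e g))
      map_smul' := fun c ξ => by ext1; funext g; exact map_smul (T g) c (ξ (e g)) }
    |C| fun ξ => lp_norm_le_of_forall e C ξ _ fun g => (T g).le_of_opNorm_le (hT g) _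

@[simp]
theorem diagOp_apply (e : G ≃ G) (T : G → E →L[ℂ] E) (C : ℝ) (hT : ∀ g, ‖T g‖ ≤ C)
    (ξ : lp (fun _ : G => E) 2) (g : G) : diagOp e T C hT ξ g = T g (ξ (e g)) := rfl

theorem norm_compOp_le (e : G ≃ G) (T : E →L[ℂ] E) : ‖compOp e T‖ ≤ ‖T‖ :=
  LinearMap.mkContinuous_norm_le _ (norm_nonneg _) _

theorem inner_compOp_left (e : G ≃ G) {T T' : E →L[ℂ] E} (hT : ∀ ψ φ, ⟪T ψ, φ⟫_ℂ = ⟪ψ, T' φ⟫_ℂ)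
    (ξ η : lp (fun _ : G => E) 2) : ⟪compOp e T ξ, η⟫_ℂ = ⟪ξ, compOp e.symm T' η⟫_ℂ := by
  rw [lp.inner_eq_tsum, lp.inner_eq_tsum, ← e.tsum_eq (fun g => ⟪ξ g, compOp e.symm T' η g⟫_ℂ)]
  refine tsum_congr fun g => ?_
  simp [hT]

theorem star_compOp [CompleteSpace E] (e : G ≃ G) {T T' : E →L[ℂ] E}
    (hT : ∀ ψ φ, ⟪T ψ, φ⟫_ℂ = ⟪ψ, T' φ⟫_ℂ) : star (compOp e T) = compOp e.symm T' := by
  have := (ContinuousLinearMap.eq_adjoint_iff (compOp e T) (compOp e.symm T')).2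
    (inner_compOp_left e hT)
  rw [ContinuousLinearMap.star_eq_adjoint, this, ContinuousLinearMap.adjoint_adjoint]

end DiagonalOperator

/-! ### Generated von Neumann algebras and commutants. -/

section VonNeumannClosure

variable {K : Type u} [NormedAddCommGroup K] [InnerProductSpace ℂ K] [CompleteSpace K]
  {S S' : Set (K →L[ℂ] K)}

theorem subset_vonNeumannClosure : S ⊆ (vonNeumannClosure S : Set (K →L[ℂ] K)) := fun x hx =>
  StarSubalgebra.mem_centralizer_iff ℂ |>.2 fun g hg => by
    have hg' := (StarSubalgebra.mem_centralizer_iff ℂ).1 hg x hx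
    refine ⟨hg'.1.symm, ?_⟩
    have := congrArg star hg'.2
    simpa using this

theorem commute_of_mem_vonNeumannClosure {x R : K →L[ℂ] K} (hx : x ∈ vonNeumannClosure S)
    (hR : ∀ s ∈ S, s * R = R * s ∧ star s * R = R * star s) : R * x = x * R :=
  ((StarSubalgebra.mem_centralizer_iff ℂ).1 hx R ((StarSubalgebra.mem_centralizer_iff ℂ).2 hR)).1

theorem mem_vonNeumannAlgebra_of_commute {P : VonNeumannAlgebra K} {x : K →L[ℂ] K}
    (h : ∀ T ∈ P.commutant, T * x = x * T) : x ∈ P := by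
  rw [← VonNeumannAlgebra.commutant_commutant P, VonNeumannAlgebra.mem_commutant_iff]
  exact h

theorem vonNeumannClosure_le {P : VonNeumannAlgebra K} (h : S ⊆ (P : Set (K →L[ℂ] K))) :
    vonNeumannClosure S ≤ P := fun x hx => by
  refine mem_vonNeumannAlgebra_of_commute fun T hT => ?_
  rw [VonNeumannAlgebra.mem_commutant_iff] at hT
  exact commute_of_mem_vonNeumannClosure hx fun s hs => ⟨hT s (h hs), hT _ (star_mem (h hs))⟩

end VonNeumannClosure

/-! ### Coordinate vectors and the test vectors `b ⊗ δ_g`. -/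

section CrossedSpace

variable {G : Type v} {X : Type u} [MeasurableSpace X] {μ : Measure X}

open Classical in
/-- The embedding of `L²(X)` into `ℓ²(G, L²(X))` as the coordinate space at `g`. -/
noncomputable def sgl (g : G) : Lp ℂ 2 μ →L[ℂ] CrossedSpace G μ :=
  lp.singleContinuousLinearMap ℂ (fun _ : G => Lp ℂ 2 μ) 2 g

@[simp]
theorem sgl_apply_self (g : G) (ψ : Lp ℂ 2 μ) : sgl g ψ g = ψ := by
  classical simp [sgl]

theorem sgl_apply_ne {g k : G} (h : k ≠ g) (ψ : Lp ℂ 2 μ) : sgl g ψ k = 0 := by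
  classical
  simp only [sgl, lp.singleContinuousLinearMap_apply]
  exact lp.single_apply_ne _ _ _ h

theorem inner_sgl_left (g : G) (ψ : Lp ℂ 2 μ) (ξ : CrossedSpace G μ) :
    ⟪sgl g ψ, ξ⟫_ℂ = ⟪ψ, ξ g⟫_ℂ := by
  classical exact lp.inner_single_left (𝕜 := ℂ) (G := fun _ : G => Lp ℂ 2 μ) g ψ ξ

theorem inner_sgl_right (g : G) (ψ : Lp ℂ 2 μ) (ξ : CrossedSpace G μ) :
    ⟪ξ, sgl g ψ⟫_ℂ = ⟪ξ g, ψ⟫_ℂ := by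
  classical exact lp.inner_single_right (𝕜 := ℂ) (G := fun _ : G => Lp ℂ 2 μ) g ψ ξ

theorem hasSum_sgl (ξ : CrossedSpace G μ) : HasSum (fun g => sgl g (ξ g)) ξ := by
  classical exact lp.hasSum_single (by norm_num) ξ

theorem compOp_sgl (e : G ≃ G) (T : Lp ℂ 2 μ →L[ℂ] Lp ℂ 2 μ) (g : G) (ψ : Lp ℂ 2 μ) :
    compOp e T (sgl g ψ) = sgl (e.symm g) (T ψ) := by
  ext1; funext k
  rw [compOp_apply]
  by_cases h : k = e.symm g
  · subst h; simp
  · rw [sgl_apply_ne h, sgl_apply_ne, map_zero]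
    rintro rfl
    simp at h

theorem diagOp_sgl (e : G ≃ G) (T : G → Lp ℂ 2 μ →L[ℂ] Lp ℂ 2 μ) (C : ℝ) (hT : ∀ g, ‖T g‖ ≤ C)
    (g : G) (ψ : Lp ℂ 2 μ) : diagOp e T C hT (sgl g ψ) = sgl (e.symm g) (T (e.symm g) ψ) := by
  ext1; funext k
  rw [diagOp_apply]
  by_cases h : k = e.symm g
  · subst h; simp
  · rw [sgl_apply_ne h, sgl_apply_ne, map_zero]
    rintro rfl
    simp at h

theorem mulOp_apply (f : Lp ℂ ∞ μ) (ξ : CrossedSpace G μ) (g : G) :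
    mulOp G f ξ g = mulL f (ξ g) := rfl

theorem mulOp_sgl (f : Lp ℂ ∞ μ) (g : G) (ψ : Lp ℂ 2 μ) :
    mulOp G f (sgl g ψ) = sgl g (mulL f ψ) :=
  compOp_sgl _ _ _ _

theorem norm_mulOp_le (f : Lp ℂ ∞ μ) : ‖mulOp G f‖ ≤ ‖f‖ :=
  (norm_compOp_le _ _).trans (norm_mulL_le f)

theorem star_mulOp (f : Lp ℂ ∞ μ) : star (mulOp G f) = mulOp G (star f) :=
  star_compOp _ (inner_mulL_left f)

variable [IsProbabilityMeasure μ]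

theorem eq_zero_of_forall_inner_sgl {ξ : CrossedSpace G μ}
    (h : ∀ (g : G) (f : Lp ℂ ∞ μ), ⟪ξ, sgl g (mulL f (oneL μ))⟫_ℂ = 0) : ξ = 0 := by
  ext1; funext g
  refine eq_zero_of_forall_inner_mulL_oneL fun f => ?_
  rw [← inner_sgl_right, h]

theorem eq_of_forall_inner_sgl {ξ η : CrossedSpace G μ}
    (h : ∀ (g : G) (f : Lp ℂ ∞ μ), ⟪ξ, sgl g (mulL f (oneL μ))⟫_ℂ = ⟪η, sgl g (mulL f (oneL μ))⟫_ℂ) :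
    ξ = η := by
  rw [← sub_eq_zero]
  exact eq_zero_of_forall_inner_sgl fun g f => by rw [inner_sub_left, h, sub_self]

/-- The test vectors separate points. Applying this first to values of `A` and `B`, then to values
of their adjoints, replaces a density argument. -/
theorem operator_eq_of_forall_inner_sgl {A B : CrossedSpace G μ →L[ℂ] CrossedSpace G μ}
    (h : ∀ (g : G) (b : Lp ℂ ∞ μ) (k : G) (c : Lp ℂ ∞ μ),
      ⟪A (sgl g (mulL b (oneL μ))), sgl k (mulL c (oneL μ))⟫_ℂ =
        ⟪B (sgl g (mulL b (oneL μ))), sgl k (mulL c (oneL μ))⟫_ℂ) : A = B := by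
  have h1 : ∀ (g : G) (b : Lp ℂ ∞ μ), A (sgl g (mulL b (oneL μ))) = B (sgl g (mulL b (oneL μ))) :=
    fun g b => eq_of_forall_inner_sgl (h g b)
  have h2 : A.adjoint = B.adjoint := by
    ext1 ξ
    refine eq_of_forall_inner_sgl fun g b => ?_
    rw [ContinuousLinearMap.adjoint_inner_left, ContinuousLinearMap.adjoint_inner_left, h1]
  exact ContinuousLinearMap.adjoint.injective h2

end CrossedSpace

/-! ### Right multiplications, the conjugation `J` and the trace vector. -/

section Commutant

variable {G : Type v} [Group G] {X : Type u} [MeasurableSpace X] {μ : Measure X}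
  [MulAction G X] [MeasurableConstSMul G X] [SMulInvariantMeasure G X μ]

theorem unitaryOp_apply (s : G) (ξ : CrossedSpace G μ) (g : G) :
    unitaryOp μ s ξ g = koopman μ 2 s (ξ (s⁻¹ * g)) := rfl

theorem unitaryOp_sgl (s g : G) (ψ : Lp ℂ 2 μ) :
    unitaryOp μ s (sgl g ψ) = sgl (s * g) (koopman μ 2 s ψ) := by
  have e : (Equiv.mulLeft s⁻¹).symm g = s * g := by simp
  exact (compOp_sgl (Equiv.mulLeft s⁻¹) (koopmanIso μ s).toContinuousLinearMap g ψ).trans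
    (congrArg (fun k => sgl k (koopman μ 2 s ψ)) e)

theorem star_unitaryOp (s : G) : star (unitaryOp μ s) = unitaryOp μ s⁻¹ := by
  have := star_compOp (Equiv.mulLeft s⁻¹) (T := (koopmanIso μ s).toContinuousLinearMap)
    (T' := (koopmanIso μ s⁻¹).toContinuousLinearMap) (inner_koopman_left s)
  simpa [unitaryOp, koopmanIso] using this

variable (μ) in
/-- The right translation `(ρ_g ξ)(k) = ξ(k g⁻¹)`. -/
noncomputable def rightTranslation (g : G) : CrossedSpace G μ →L[ℂ] CrossedSpace G μ :=
  compOp (Equiv.mulRight g⁻¹) (ContinuousLinearMap.id ℂ _)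

omit [MulAction G X] [MeasurableConstSMul G X] [SMulInvariantMeasure G X μ] in
theorem rightTranslation_apply (g : G) (ξ : CrossedSpace G μ) (k : G) :
    rightTranslation μ g ξ k = ξ (k * g⁻¹) := rfl

omit [MulAction G X] [MeasurableConstSMul G X] [SMulInvariantMeasure G X μ] in
theorem rightTranslation_sgl (g k : G) (ψ : Lp ℂ 2 μ) :
    rightTranslation μ g (sgl k ψ) = sgl (k * g) ψ := by
  have e : (Equiv.mulRight g⁻¹).symm k = k * g := by simp
  exact (compOp_sgl (Equiv.mulRight g⁻¹) (ContinuousLinearMap.id ℂ (Lp ℂ 2 μ)) k ψ).trans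
    (congrArg (fun k => sgl k ψ) e)

/-- The operator `ξ ↦ (k ↦ σ_{k g⁻¹}(b) ξ(k g⁻¹))`, which is right multiplication by `b u_g`. -/
noncomputable def rightOp (b : Lp ℂ ∞ μ) (g : G) : CrossedSpace G μ →L[ℂ] CrossedSpace G μ :=
  diagOp (Equiv.mulRight g⁻¹) (fun k => mulL (koopman μ ∞ (k * g⁻¹) b)) ‖b‖
    fun _ => (norm_mulL_le _).trans (norm_koopman _ b).le

theorem rightOp_apply (b : Lp ℂ ∞ μ) (g : G) (ξ : CrossedSpace G μ) (k : G) :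
    rightOp b g ξ k = mulL (koopman μ ∞ (k * g⁻¹) b) (ξ (k * g⁻¹)) := rfl

theorem rightOp_sgl_one (b : Lp ℂ ∞ μ) (g : G) (ψ : Lp ℂ 2 μ) :
    rightOp b g (sgl 1 ψ) = sgl g (mulL b ψ) := by
  have e : (Equiv.mulRight g⁻¹).symm 1 = g := by simp
  have := diagOp_sgl (Equiv.mulRight g⁻¹) (fun k => mulL (koopman μ ∞ (k * g⁻¹) b)) ‖b‖
    (fun k => (norm_mulL_le _).trans (norm_koopman _ b).le) 1 ψ
  rw [e, mul_inv_cancel, koopman_one] at this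
  exact this

omit [Group G] [MulAction G X] [MeasurableConstSMul G X] [SMulInvariantMeasure G X μ] in
theorem operator_ext {A B : CrossedSpace G μ →L[ℂ] CrossedSpace G μ}
    (h : ∀ ξ k, A ξ k = B ξ k) : A = B :=
  ContinuousLinearMap.ext fun ξ => lp.ext (funext (h ξ))

/-- Both families of generators are closed under adjoints, so no separate condition on adjoints is
needed. -/
theorem commute_of_mem_crossedProduct {x R : CrossedSpace G μ →L[ℂ] CrossedSpace G μ}
    (hx : x ∈ crossedProduct G μ) (h1 : ∀ f ξ k, mulOp G f (R ξ) k = R (mulOp G f ξ) k)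
    (h2 : ∀ s ξ k, unitaryOp μ s (R ξ) k = R (unitaryOp μ s ξ) k) (ξ : CrossedSpace G μ) :
    x (R ξ) = R (x ξ) := by
  have h1' (f) : mulOp G f * R = R * mulOp G f := operator_ext (h1 f)
  have h2' (s : G) : unitaryOp μ s * R = R * unitaryOp μ s := operator_ext (h2 s)
  have key : R * x = x * R := by
    refine commute_of_mem_vonNeumannClosure hx ?_
    rintro _ (⟨f, rfl⟩ | ⟨s, rfl⟩)
    · exact ⟨h1' f, by rw [star_mulOp, h1']⟩
    · exact ⟨h2' s, by rw [star_unitaryOp, h2']⟩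
  exact (DFunLike.congr_fun key ξ).symm

theorem rightTranslation_commute {x : CrossedSpace G μ →L[ℂ] CrossedSpace G μ}
    (hx : x ∈ crossedProduct G μ) (g : G) (ξ : CrossedSpace G μ) :
    x (rightTranslation μ g ξ) = rightTranslation μ g (x ξ) := by
  refine commute_of_mem_crossedProduct hx (fun f ξ k => ?_) (fun s ξ k => ?_) ξ
  · rw [rightTranslation_apply, mulOp_apply, mulOp_apply, rightTranslation_apply]
  · rw [rightTranslation_apply, unitaryOp_apply, unitaryOp_apply, rightTranslation_apply, mul_assoc]

theorem rightOp_commute {x : CrossedSpace G μ →L[ℂ] CrossedSpace G μ}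
    (hx : x ∈ crossedProduct G μ) (b : Lp ℂ ∞ μ) (g : G) (ξ : CrossedSpace G μ) :
    x (rightOp b g ξ) = rightOp b g (x ξ) := by
  refine commute_of_mem_crossedProduct hx (fun f ξ k => ?_) (fun s ξ k => ?_) ξ
  · rw [rightOp_apply, mulOp_apply, mulOp_apply, rightOp_apply, mulL_comm]
  · rw [rightOp_apply, unitaryOp_apply, unitaryOp_apply, rightOp_apply, koopman_mulL,
      ← koopman_mul, mul_assoc, mul_inv_cancel_left]

variable (μ) in
/-- The conjugation `(J ξ)(g) = σ_g (ξ(g⁻¹))^*` of `ℓ²(G, L²(X))`. -/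
noncomputable def conjOp (ξ : CrossedSpace G μ) : CrossedSpace G μ :=
  star (diagOp (Equiv.inv G) (fun g => (koopmanIso μ g).toContinuousLinearMap) 1
    (fun g => (koopmanIso μ g).norm_toContinuousLinearMap_le) ξ)

theorem conjOp_apply (ξ : CrossedSpace G μ) (g : G) :
    conjOp μ ξ g = star (koopman μ 2 g (ξ g⁻¹)) := rfl

theorem continuous_conjOp : Continuous (conjOp μ : CrossedSpace G μ → _) :=
  continuous_star.comp (ContinuousLinearMap.continuous _)

theorem conjOp_sgl_one (ψ : Lp ℂ 2 μ) : conjOp μ (sgl (1 : G) ψ) = sgl 1 (star ψ) := by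
  ext1; funext g
  rw [conjOp_apply]
  by_cases h : g = 1
  · subst h; simp [koopman_one]
  · rw [sgl_apply_ne (inv_ne_one.2 h), sgl_apply_ne h, ← koopmanIso_apply, map_zero, star_zero]

variable [IsProbabilityMeasure μ]

variable (G μ) in
/-- The vector `1 ⊗ δ_e`, implementing the trace of the crossed product. -/
noncomputable def traceVector : CrossedSpace G μ := sgl 1 (oneL μ)

theorem rightOp_traceVector (b : Lp ℂ ∞ μ) (g : G) :
    rightOp b g (traceVector G μ) = sgl g (mulL b (oneL μ)) :=
  rightOp_sgl_one b g _

/-- This is the trace property. Each test vector is `RΩ` with `R` a right multiplication, so `⟪x*Ω,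
RΩ⟫ = ⟪Ω, R(xΩ)⟫`, and invariance of the measure turns this into a pairing with `J(xΩ)`. -/
theorem star_apply_traceVector {x : CrossedSpace G μ →L[ℂ] CrossedSpace G μ}
    (hx : x ∈ crossedProduct G μ) :
    star x (traceVector G μ) = conjOp μ (x (traceVector G μ)) := by
  refine eq_of_forall_inner_sgl fun g f => ?_
  have h1 : ⟪star x (traceVector G μ), sgl g (mulL f (oneL μ))⟫_ℂ =
      ⟪oneL μ, mulL f (koopman μ 2 g (x (traceVector G μ) g⁻¹))⟫_ℂ := by
    rw [← rightOp_traceVector, ContinuousLinearMap.star_eq_adjoint,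
      ContinuousLinearMap.adjoint_inner_left, rightOp_commute hx]
    generalize x (traceVector G μ) = ξ
    rw [traceVector, inner_sgl_left, rightOp_apply, one_mul, ← inner_koopman g, koopman_mulL,
      ← koopman_mul, mul_inv_cancel, koopman_one, koopman_oneL]
  rw [h1, inner_sgl_right, conjOp_apply]
  generalize koopman μ 2 g (x (traceVector G μ) g⁻¹) = ψ
  rw [L2.inner_def, L2.inner_def]
  refine integral_congr_ae ?_
  filter_upwards [coeFn_mulL f ψ, coeFn_mulL f (oneL μ), coeFn_oneL (μ := μ), Lp.coeFn_star ψ]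
    with x h1 h2 h3 h4
  simp only [h1, h2, h3, h4, RCLike.inner_apply, Pi.star_apply, RCLike.star_def]
  simp

end Commutant

/-! ### The space `L²(P)` and the use of the ICC condition. -/

section Intermediate

variable {G : Type v} [Group G] {X : Type u} [MeasurableSpace X] {μ : Measure X}
  [MulAction G X] [MeasurableConstSMul G X] [SMulInvariantMeasure G X μ] [IsProbabilityMeasure μ]

/-- The orbit of the trace vector under a von Neumann algebra `P`. -/
noncomputable def orbit (P : VonNeumannAlgebra (CrossedSpace G μ)) :
    Submodule ℂ (CrossedSpace G μ) where
  carrier := {ξ | ∃ p ∈ P, p (traceVector G μ) = ξ}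
  zero_mem' := ⟨0, zero_mem P, rfl⟩
  add_mem' := by
    rintro _ _ ⟨p, hp, rfl⟩ ⟨q, hq, rfl⟩
    exact ⟨p + q, add_mem hp hq, rfl⟩
  smul_mem' := by
    rintro c _ ⟨p, hp, rfl⟩
    exact ⟨c • p, P.toStarSubalgebra.smul_mem hp c, rfl⟩

/-- The closure `L²(P)` of the orbit of the trace vector. -/
noncomputable def traceSpace (P : VonNeumannAlgebra (CrossedSpace G μ)) :
    Submodule ℂ (CrossedSpace G μ) :=
  (orbit P).topologicalClosure

instance (P : VonNeumannAlgebra (CrossedSpace G μ)) : CompleteSpace (traceSpace P) :=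
  inferInstanceAs (CompleteSpace (orbit P).topologicalClosure)

variable {P : VonNeumannAlgebra (CrossedSpace G μ)}

theorem isClosed_traceSpace : IsClosed (traceSpace P : Set (CrossedSpace G μ)) :=
  Submodule.isClosed_topologicalClosure _

theorem apply_traceVector_mem {p : CrossedSpace G μ →L[ℂ] CrossedSpace G μ} (hp : p ∈ P) :
    p (traceVector G μ) ∈ traceSpace P :=
  Submodule.le_topologicalClosure _ ⟨p, hp, rfl⟩

theorem traceSpace_induction {C : Set (CrossedSpace G μ)} (hC : IsClosed C)
    (h : ∀ p ∈ P, p (traceVector G μ) ∈ C) {ξ : CrossedSpace G μ} (hξ : ξ ∈ traceSpace P) :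
    ξ ∈ C := by
  refine closure_minimal ?_ hC hξ
  rintro _ ⟨p, hp, rfl⟩
  exact h p hp

theorem apply_mem_traceSpace {p : CrossedSpace G μ →L[ℂ] CrossedSpace G μ} (hp : p ∈ P)
    {ξ : CrossedSpace G μ} (hξ : ξ ∈ traceSpace P) : p ξ ∈ traceSpace P :=
  traceSpace_induction (C := p ⁻¹' traceSpace P) (isClosed_traceSpace.preimage p.continuous)
    (fun _ hq => apply_traceVector_mem (mul_mem hp hq)) hξ

/-- For `ξ = pΩ`, the operator `p` commutes with `T` and with right multiplications, moves across
the inner product as `p*`, and `p*Ω = J(pΩ)`. Both sides are continuous in `ξ`, so the identity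
passes to the closure. -/
theorem inner_commutant_apply (hPM : P ≤ crossedProduct G μ)
    {T : CrossedSpace G μ →L[ℂ] CrossedSpace G μ} (hT : T ∈ P.commutant)
    {ξ : CrossedSpace G μ} (hξ : ξ ∈ traceSpace P) (b c : Lp ℂ ∞ μ) (g k : G) :
    ⟪T (rightOp b g ξ), rightOp c k (traceVector G μ)⟫_ℂ =
      ⟪T (rightOp b g (traceVector G μ)), rightOp c k (conjOp μ ξ)⟫_ℂ := by
  have hcl : IsClosed {ξ | ⟪T (rightOp b g ξ), rightOp c k (traceVector G μ)⟫_ℂ =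
      ⟪T (rightOp b g (traceVector G μ)), rightOp c k (conjOp μ ξ)⟫_ℂ} := by
    have h1 : Continuous fun ξ => T (rightOp b g ξ) :=
      T.continuous.comp (ContinuousLinearMap.continuous _)
    have h2 : Continuous fun ξ => rightOp c k (conjOp μ ξ) :=
      (ContinuousLinearMap.continuous _).comp continuous_conjOp
    exact isClosed_eq (h1.inner continuous_const) (continuous_const.inner h2)
  refine traceSpace_induction hcl (fun p hp => ?_) hξ
  have hpT : ∀ η, p (T η) = T (p η) :=
    fun η => DFunLike.congr_fun (VonNeumannAlgebra.mem_commutant_iff.1 hT p hp) η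
  rw [Set.mem_ofPred_eq, ← star_apply_traceVector (hPM hp), ← rightOp_commute (hPM hp),
    ← rightOp_commute (star_mem (hPM hp)), ← hpT, ContinuousLinearMap.star_eq_adjoint,
    ContinuousLinearMap.adjoint_inner_right]

/-- With `ξ = xΩ`, the preceding identity says that `x` commutes weakly with each `T` in the
commutant of `P`; the bicommutant theorem concludes. -/
theorem mem_of_apply_traceVector_mem (hPM : P ≤ crossedProduct G μ)
    {x : CrossedSpace G μ →L[ℂ] CrossedSpace G μ} (hx : x ∈ crossedProduct G μ)
    (h : x (traceVector G μ) ∈ traceSpace P) : x ∈ P := by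
  refine mem_vonNeumannAlgebra_of_commute fun T hT => ?_
  refine operator_eq_of_forall_inner_sgl fun g b k c => ?_
  change ⟪T (x _), _⟫_ℂ = ⟪x (T _), _⟫_ℂ
  rw [← rightOp_traceVector, ← rightOp_traceVector, rightOp_commute hx, inner_commutant_apply hPM hT h,
    ← star_apply_traceVector hx, ← rightOp_commute (star_mem hx),
    ContinuousLinearMap.star_eq_adjoint, ContinuousLinearMap.adjoint_inner_right]

theorem mulOp_mem_crossedProduct (f : Lp ℂ ∞ μ) : mulOp G f ∈ crossedProduct G μ :=
  subset_vonNeumannClosure (Or.inl ⟨f, rfl⟩)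

theorem unitaryOp_mem_groupAlgebra (s : G) : unitaryOp μ s ∈ groupAlgebra G μ :=
  subset_vonNeumannClosure ⟨s, rfl⟩

theorem mulOp_mem_iff (hPM : P ≤ crossedProduct G μ) (f : Lp ℂ ∞ μ) :
    mulOp G f ∈ P ↔ sgl 1 (mulL f (oneL μ)) ∈ traceSpace P := by
  rw [← mulOp_sgl]
  exact ⟨apply_traceVector_mem, mem_of_apply_traceVector_mem hPM (mulOp_mem_crossedProduct f)⟩

/-- Right translation commutes with `P` and sends `Ω` to `u_gΩ`, where `u_g ∈ P`. -/
theorem rightTranslation_mem (hGP : groupAlgebra G μ ≤ P) (hPM : P ≤ crossedProduct G μ) (g : G)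
    {ξ : CrossedSpace G μ} (hξ : ξ ∈ traceSpace P) : rightTranslation μ g ξ ∈ traceSpace P := by
  refine traceSpace_induction (C := rightTranslation μ g ⁻¹' traceSpace P)
    (isClosed_traceSpace.preimage (ContinuousLinearMap.continuous _)) (fun p hp => ?_) hξ
  have h : rightTranslation μ g (traceVector G μ) = unitaryOp μ g (traceVector G μ) := by
    rw [traceVector, rightTranslation_sgl, unitaryOp_sgl, koopman_oneL, one_mul, mul_one]
  rw [Set.mem_preimage, ← rightTranslation_commute (hPM hp), h]
  exact apply_mem_traceSpace hp (apply_traceVector_mem (hGP (unitaryOp_mem_groupAlgebra g)))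

variable {H : Subgroup G}

theorem conjugation_mem (htriv : ∀ h ∈ H, ∀ᵐ x ∂μ, h • x = x) (hGP : groupAlgebra G μ ≤ P)
    (hPM : P ≤ crossedProduct G μ) {h : G} (hh : h ∈ H) {ξ : CrossedSpace G μ}
    (hξ : ξ ∈ traceSpace P) :
    compOp (MulAut.conj h⁻¹).toEquiv (ContinuousLinearMap.id ℂ (Lp ℂ 2 μ)) ξ ∈ traceSpace P := by
  have : compOp (MulAut.conj h⁻¹).toEquiv (ContinuousLinearMap.id ℂ (Lp ℂ 2 μ)) ξ =
      unitaryOp μ h (rightTranslation μ h⁻¹ ξ) := by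
    refine lp.ext (funext fun k => ?_)
    rw [unitaryOp_apply, koopman_eq_self (htriv h⁻¹ (inv_mem hh)), rightTranslation_apply]
    rfl
  rw [this]
  exact apply_mem_traceSpace (hGP (unitaryOp_mem_groupAlgebra h)) (rightTranslation_mem hGP hPM _ hξ)

/-- Conjugation by `h` is unitary, and it and its adjoint (conjugation by `h⁻¹`) preserve `L²(P)`.
Hence it commutes with the projection, and it fixes `ψ ⊗ δ_e`. -/
theorem starProjection_sgl_conjugation (htriv : ∀ h ∈ H, ∀ᵐ x ∂μ, h • x = x)
    (hGP : groupAlgebra G μ ≤ P) (hPM : P ≤ crossedProduct G μ) (ψ : Lp ℂ 2 μ) {h : G}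
    (hh : h ∈ H) (k : G) :
    (traceSpace P).starProjection (sgl 1 ψ) (h⁻¹ * k * h) =
      (traceSpace P).starProjection (sgl 1 ψ) k := by
  set C := compOp (MulAut.conj h⁻¹).toEquiv (ContinuousLinearMap.id ℂ (Lp ℂ 2 μ)) with hC
  have hv : C (sgl 1 ψ) = sgl 1 ψ := by
    rw [hC, compOp_sgl]
    congr 1
    simp
  have hη : (traceSpace P).starProjection (sgl 1 ψ) = C ((traceSpace P).starProjection (sgl 1 ψ)) := by
    refine Submodule.eq_starProjection_of_mem_of_inner_eq_zero
      (conjugation_mem htriv hGP hPM hh (Submodule.starProjection_apply_mem _ _))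
      fun w hw => ?_
    nth_rewrite 1 [← hv]
    rw [← map_sub, hC, inner_compOp_left (T' := ContinuousLinearMap.id ℂ (Lp ℂ 2 μ)) _
      (fun _ _ => rfl)]
    refine Submodule.starProjection_inner_eq_zero _ _ ?_
    have := conjugation_mem htriv hGP hPM (inv_mem hh) hw
    rw [inv_inv] at this
    have e : (MulAut.conj h⁻¹).toEquiv.symm = (MulAut.conj h).toEquiv := Equiv.ext fun k => by
      change (MulAut.conj h⁻¹).symm k = MulAut.conj h k
      rw [MulAut.conj_symm_apply, MulAut.conj_apply, inv_inv]
    rwa [e]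
  have := congrArg (fun ξ : CrossedSpace G μ => ξ k) hη
  simp only [hC, compOp_apply] at this
  rw [this]
  simp

/-- A nonzero value at `k ≠ e` would be repeated along the infinite `H`-conjugacy orbit of `k`,
against square summability. -/
theorem starProjection_sgl_apply_ne (hH : IsStronglyRelativelyICC H)
    (htriv : ∀ h ∈ H, ∀ᵐ x ∂μ, h • x = x) (hGP : groupAlgebra G μ ≤ P)
    (hPM : P ≤ crossedProduct G μ) (ψ : Lp ℂ 2 μ) {k : G} (hk : k ≠ 1) :
    (traceSpace P).starProjection (sgl 1 ψ) k = 0 := by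
  by_contra hne
  set η := (traceSpace P).starProjection (sgl 1 ψ) with hη
  have hpos : 0 < ‖η k‖ ^ 2 := by positivity
  have hfin := Filter.eventually_cofinite.1
    ((lp_summable_norm_sq η).tendsto_cofinite_zero.eventually_lt_const hpos)
  refine hH k hk (hfin.subset ?_)
  rintro _ ⟨h, hh, rfl⟩
  have := starProjection_sgl_conjugation htriv hGP hPM ψ (inv_mem hh) k
  rw [inv_inv, ← hη] at this
  simp [this]

theorem sgl_mem_traceSpace (hH : IsStronglyRelativelyICC H)
    (htriv : ∀ h ∈ H, ∀ᵐ x ∂μ, h • x = x) (hGP : groupAlgebra G μ ≤ P)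
    (hPM : P ≤ crossedProduct G μ) {ξ : CrossedSpace G μ} (hξ : ξ ∈ traceSpace P) (g : G) :
    sgl 1 (ξ g) ∈ traceSpace P := by
  wlog hg : g = 1 generalizing ξ g
  · have := this (rightTranslation_mem hGP hPM g⁻¹ hξ) 1 rfl
    rwa [rightTranslation_apply, inv_inv, one_mul] at this
  subst hg
  set η := (traceSpace P).starProjection (sgl (1 : G) (ξ 1)) with hη
  have hηS : η ∈ traceSpace P := Submodule.starProjection_apply_mem _ _
  have hη1 : η = sgl 1 (η 1) := by
    refine lp.ext (funext fun k => ?_)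
    by_cases hk : k = 1
    · subst hk; simp
    · rw [sgl_apply_ne hk, hη, starProjection_sgl_apply_ne hH htriv hGP hPM _ hk]
  have horth : ∀ w ∈ traceSpace P, ⟪ξ 1 - η 1, w 1⟫_ℂ = 0 := fun w hw => by
    rw [← inner_sgl_left (1 : G), map_sub, ← hη1]
    exact Submodule.starProjection_inner_eq_zero _ _ hw
  -- Both `ξ` and `η` lie in `L²(P)`, so `ξ 1 - η 1` is orthogonal to itself.
  have : ξ 1 = η 1 := by
    rw [← sub_eq_zero, ← inner_self_eq_zero (𝕜 := ℂ), inner_sub_right, horth ξ hξ, horth η hηS,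
      sub_self]
  rw [this, ← hη1]
  exact hηS

end Intermediate

/-! ### Bounded representatives and products in `L^∞`. -/

section Truncation

variable {X : Type u} [MeasurableSpace X] {μ : Measure X}

theorem exists_top_eq {φ : X → ℂ} (hφ : Measurable φ) {C : ℝ} (hC : 0 ≤ C)
    (h : ∀ x, ‖φ x‖ ≤ C) : ∃ f : Lp ℂ ∞ μ, f =ᵐ[μ] φ ∧ ‖f‖ ≤ C := by
  have hm : MemLp φ ∞ μ := memLp_top_of_bound hφ.aestronglyMeasurable C (.of_forall h)
  refine ⟨hm.toLp φ, hm.coeFn_toLp, ?_⟩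
  rw [Lp.norm_toLp]
  refine ENNReal.toReal_le_of_le_ofReal hC ?_
  rw [eLpNorm_exponent_top]
  exact eLpNormEssSup_le_of_ae_bound (.of_forall h)

theorem exists_top_mul (f h : Lp ℂ ∞ μ) : ∃ k : Lp ℂ ∞ μ, k =ᵐ[μ] fun x => f x * h x :=
  ⟨_, (ContinuousLinearMap.mul ℂ ℂ).coeFn_holder (r := ∞) f h⟩

theorem mulL_mulL {f h k : Lp ℂ ∞ μ} (hk : k =ᵐ[μ] fun x => f x * h x) (ψ : Lp ℂ 2 μ) :
    mulL f (mulL h ψ) = mulL k ψ := by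
  apply Lp.ext
  filter_upwards [coeFn_mulL f (mulL h ψ), coeFn_mulL h ψ, coeFn_mulL k ψ, hk] with x h1 h2 h3 h4
  rw [h1, h2, h3, h4, mul_assoc]

theorem mulOp_mul {G : Type v} {f h k : Lp ℂ ∞ μ} (hk : k =ᵐ[μ] fun x => f x * h x) :
    mulOp G f * mulOp G h = mulOp G k :=
  operator_ext fun ξ g => mulL_mulL hk (ξ g)

variable [IsProbabilityMeasure μ]

theorem star_indTop {E : Set X} (hE : MeasurableSet E) :
    star (indTop hE : Lp ℂ ∞ μ) = indTop hE := by
  apply Lp.ext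
  filter_upwards [Lp.coeFn_star (indTop hE : Lp ℂ ∞ μ), coeFn_indTop (μ := μ) hE] with x h1 h2
  rw [h1, Pi.star_apply, h2]
  by_cases hx : x ∈ E <;> simp [hx]

end Truncation

/-! ### Sublevel sets of functions in `L²(P)` give projections of `P`. -/

section Spectral

variable {G : Type v} [Group G] {X : Type u} [MeasurableSpace X] {μ : Measure X}
  [MulAction G X] [MeasurableConstSMul G X] [SMulInvariantMeasure G X μ] [IsProbabilityMeasure μ]
  {P : VonNeumannAlgebra (CrossedSpace G μ)}

/-- A weak form of the statement that `T` commutes with multiplication by the possibly unbounded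
function `a`. -/
theorem inner_commutant_sgl (hPM : P ≤ crossedProduct G μ)
    {T : CrossedSpace G μ →L[ℂ] CrossedSpace G μ} (hT : T ∈ P.commutant)
    {a : Lp ℂ 2 μ} (ha : sgl 1 a ∈ traceSpace P) (b c : Lp ℂ ∞ μ) (g k : G) :
    ⟪T (sgl g (mulL b a)), sgl k (mulL c (oneL μ))⟫_ℂ =
      ⟪T (sgl g (mulL b (oneL μ))), sgl k (mulL c (star a))⟫_ℂ := by
  have := inner_commutant_apply hPM hT ha b c g k
  rwa [rightOp_traceVector, rightOp_traceVector, conjOp_sgl_one, rightOp_sgl_one,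
    rightOp_sgl_one] at this

/-- Heuristically `T` commutes with `φ`, so the corner `Z = 1_F T 1_N` satisfies `Z = φ⁻¹ Z φ`, with
`|φ| ≤ t` on `N` and `|φ⁻¹| ≤ 1/s` on `F`. As `t/s < 1`, this forces `Z = 0`. -/
theorem commutant_off_diagonal (hPM : P ≤ crossedProduct G μ)
    {T : CrossedSpace G μ →L[ℂ] CrossedSpace G μ} (hT : T ∈ P.commutant)
    {φ : X → ℂ} (hφm : Measurable φ) (hφ : MemLp φ 2 μ) (ha : sgl 1 (hφ.toLp φ) ∈ traceSpace P)
    {s t : ℝ} (ht : 0 ≤ t) (hst : t < s) (hN : MeasurableSet {x | ‖φ x‖ ≤ t})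
    (hF : MeasurableSet {x | s ≤ ‖φ x‖}) :
    mulOp G (indTop hF) * T * mulOp G (indTop hN) = 0 := by
  have hs : 0 < s := ht.trans_lt hst
  obtain ⟨a₁, ha₁, ha₁n⟩ := exists_top_eq (μ := μ) (hφm.indicator hN) ht fun x => by
    by_cases hx : x ∈ {x | ‖φ x‖ ≤ t}
    · rw [Set.indicator_of_mem hx]; exact hx
    · rw [Set.indicator_of_notMem hx]; simpa using ht
  have hφi : Measurable fun x => (star (φ x))⁻¹ := by
    have : Measurable fun x => star (φ x) := continuous_star.measurable.comp hφm
    exact this.inv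
  obtain ⟨d, hd, hdn⟩ := exists_top_eq (μ := μ) (hφi.indicator hF) (inv_nonneg.2 hs.le) fun x => by
    by_cases hx : x ∈ {x | s ≤ ‖φ x‖}
    · rw [Set.indicator_of_mem hx, norm_inv, norm_star]
      exact inv_anti₀ hs hx
    · rw [Set.indicator_of_notMem hx]; simpa using hs.le
  have key : mulOp G (indTop hF) * T * mulOp G (indTop hN) =
      star (mulOp G d) * T * mulOp G a₁ := by
    refine operator_eq_of_forall_inner_sgl fun g b k c => ?_
    -- With `b' = b 1_N` and `c' = d c`, one gets `b' φ = a₁ b` and `c' star φ = 1_F c`: only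
    -- bounded multipliers remain.
    obtain ⟨b', hb'⟩ := exists_top_mul b (indTop hN)
    obtain ⟨c', hc'⟩ := exists_top_mul d c
    have h1 : mulL b' (hφ.toLp φ) = mulL a₁ (mulL b (oneL μ)) := by
      apply Lp.ext
      filter_upwards [coeFn_mulL b' (hφ.toLp φ), coeFn_mulL a₁ (mulL b (oneL μ)),
        coeFn_mulL_oneL b, hb', hφ.coeFn_toLp, ha₁, coeFn_indTop (μ := μ) hN]
        with x h1 h2 h3 h4 h5 h6 h7
      rw [h1, h2, h3, h4, h5, h6, h7]
      by_cases hx : x ∈ {x | ‖φ x‖ ≤ t} <;> simp [hx, mul_comm]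
    have h2 : mulL c' (oneL μ) = mulL d (mulL c (oneL μ)) := by
      apply Lp.ext
      filter_upwards [coeFn_mulL_oneL c', coeFn_mulL d (mulL c (oneL μ)), coeFn_mulL_oneL c, hc']
        with x h1 h2 h3 h4
      rw [h1, h2, h3, h4]
    have h3 : mulL b' (oneL μ) = mulL (indTop hN) (mulL b (oneL μ)) := by
      apply Lp.ext
      filter_upwards [coeFn_mulL_oneL b', coeFn_mulL (indTop hN) (mulL b (oneL μ)),
        coeFn_mulL_oneL b, hb'] with x h1 h2 h3 h4
      rw [h1, h2, h3, h4, mul_comm]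
    have h4 : mulL c' (star (hφ.toLp φ)) = mulL (indTop hF) (mulL c (oneL μ)) := by
      apply Lp.ext
      filter_upwards [coeFn_mulL c' (star (hφ.toLp φ)), coeFn_mulL (indTop hF) (mulL c (oneL μ)),
        coeFn_mulL_oneL c, hc', Lp.coeFn_star (hφ.toLp φ), hφ.coeFn_toLp, hd,
        coeFn_indTop (μ := μ) hF] with x h1 h2 h3 h4 h5 h6 h7 h8
      rw [h1, h2, h3, h4, h5, Pi.star_apply, h6, h7, h8]
      by_cases hx : x ∈ {x | s ≤ ‖φ x‖}
      · have h0 : star (φ x) ≠ 0 := by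
          rw [Ne, ← norm_eq_zero, norm_star]
          exact (hs.trans_le hx).ne'
        rw [Set.indicator_of_mem hx, Set.indicator_of_mem hx]
        field_simp
      · rw [Set.indicator_of_notMem hx, Set.indicator_of_notMem hx]
        simp
    have h5 := inner_commutant_sgl hPM hT ha b' c' g k
    rw [h1, h2, h3, h4, ← mulOp_sgl (indTop hN), ← mulOp_sgl (indTop hF),
      ← mulOp_sgl a₁ g (mulL b (oneL μ)), ← mulOp_sgl d k (mulL c (oneL μ))] at h5
    have h6 : mulOp G (indTop hF : Lp ℂ ∞ μ) = star (mulOp G (indTop hF)) := by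
      rw [star_mulOp, star_indTop]
    rw [h6]
    change ⟪star (mulOp G (indTop hF)) (T (mulOp G (indTop hN) _)), _⟫_ℂ =
      ⟪star (mulOp G d) (T (mulOp G a₁ _)), _⟫_ℂ
    rw [ContinuousLinearMap.star_eq_adjoint, ContinuousLinearMap.star_eq_adjoint,
      ContinuousLinearMap.adjoint_inner_left, ContinuousLinearMap.adjoint_inner_left]
    exact h5.symm
  have hA : mulOp G (indTop hN) * mulOp G a₁ = mulOp G a₁ := by
    refine mulOp_mul ?_
    filter_upwards [ha₁, coeFn_indTop (μ := μ) hN] with x h3 h4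
    rw [h3, h4]
    by_cases hx : x ∈ {x | ‖φ x‖ ≤ t} <;> simp [hx]
  have hD : star (mulOp G d) * mulOp G (indTop hF) = star (mulOp G d) := by
    rw [star_mulOp]
    refine mulOp_mul ?_
    filter_upwards [hd, coeFn_indTop (μ := μ) hF, Lp.coeFn_star d] with x h3 h5 h6
    rw [h6, Pi.star_apply, h3, h5]
    by_cases hx : x ∈ {x | s ≤ ‖φ x‖}
    · simp [Set.indicator_of_mem hx]
    · simp [Set.indicator_of_notMem hx]
  -- The cut-offs are absorbed by `star d` and `a₁`, so `key` becomes a fixed-point equation for `Z`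
  -- with contraction factor `t/s`.
  set Z := mulOp G (indTop hF) * T * mulOp G (indTop hN) with hZ
  have hfix : Z = star (mulOp G d) * Z * mulOp G a₁ := by
    calc Z = star (mulOp G d) * T * mulOp G a₁ := key
      _ = (star (mulOp G d) * mulOp G (indTop hF)) * T * (mulOp G (indTop hN) * mulOp G a₁) := by
        rw [hA, hD]
      _ = star (mulOp G d) * Z * mulOp G a₁ := by rw [hZ]; simp only [mul_assoc]
  have hle : ‖Z‖ ≤ s⁻¹ * ‖Z‖ * t := by
    calc ‖Z‖ = ‖star (mulOp G d) * Z * mulOp G a₁‖ := by rw [← hfix]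
      _ ≤ ‖star (mulOp G d) * Z‖ * ‖mulOp G a₁‖ := norm_mul_le _ _
      _ ≤ ‖star (mulOp G d)‖ * ‖Z‖ * ‖mulOp G a₁‖ := by gcongr; exact norm_mul_le _ _
      _ ≤ s⁻¹ * ‖Z‖ * t := by
        rw [ContinuousLinearMap.star_eq_adjoint, LinearIsometryEquiv.norm_map]
        gcongr
        · exact (norm_mulOp_le d).trans hdn
        · exact (norm_mulOp_le a₁).trans ha₁n
  rw [← norm_eq_zero]
  by_contra hne
  have hpos : 0 < ‖Z‖ := lt_of_le_of_ne (norm_nonneg _) (Ne.symm hne)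
  have : s⁻¹ * ‖Z‖ * t < ‖Z‖ := by
    have : s⁻¹ * t < 1 := by rw [inv_mul_lt_iff₀ hs]; simpa using hst
    nlinarith
  linarith

/-- The sets `{|φ| ≥ t + 1/(n+1)}` exhaust the complement of `N = {|φ| ≤ t}`, and the corner of `T`
from `N` to each of them vanishes. -/
theorem commutant_range_invariant (hPM : P ≤ crossedProduct G μ)
    {T : CrossedSpace G μ →L[ℂ] CrossedSpace G μ} (hT : T ∈ P.commutant)
    {φ : X → ℂ} (hφm : Measurable φ) (hφ : MemLp φ 2 μ) (ha : sgl 1 (hφ.toLp φ) ∈ traceSpace P)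
    {t : ℝ} (ht : 0 ≤ t) (hN : MeasurableSet {x | ‖φ x‖ ≤ t}) :
    mulOp G (indTop hN) * (T * mulOp G (indTop hN)) = T * mulOp G (indTop hN) := by
  refine operator_ext fun ξ k => ?_
  have hF (n : ℕ) : MeasurableSet {x | t + 1 / ((n : ℝ) + 1) ≤ ‖φ x‖} :=
    measurableSet_le measurable_const hφm.norm
  set χ : CrossedSpace G μ := T (mulOp G (indTop hN) ξ) with hχ
  have h0 (n : ℕ) : mulL (indTop (hF n)) (χ k) = 0 := by
    have := commutant_off_diagonal hPM hT hφm hφ ha ht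
      (lt_add_of_pos_right t (Nat.one_div_pos_of_nat (n := n))) hN (hF n)
    rw [mul_assoc] at this
    have := congrArg (fun A : CrossedSpace G μ →L[ℂ] CrossedSpace G μ => A ξ k) this
    exact this
  change mulL (indTop hN) (χ k) = χ k
  have h1 : ∀ᵐ x ∂μ, ∀ n : ℕ, (indTop (hF n) : Lp ℂ ∞ μ) x * χ k x = 0 := by
    rw [ae_all_iff]
    intro n
    filter_upwards [coeFn_mulL (indTop (hF n)) (χ k), Lp.eq_zero_iff_ae_eq_zero.1 (h0 n)]
      with x h2 h3
    rw [← h2, h3]; rfl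
  have h2 : ∀ᵐ x ∂μ, ∀ n : ℕ, (indTop (hF n) : Lp ℂ ∞ μ) x =
      {x | t + 1 / ((n : ℝ) + 1) ≤ ‖φ x‖}.indicator (fun _ => (1 : ℂ)) x := by
    rw [ae_all_iff]
    exact fun n => coeFn_indTop (hF n)
  apply Lp.ext
  filter_upwards [coeFn_mulL (indTop hN) (χ k), coeFn_indTop (μ := μ) hN, h1, h2] with x h3 h4 h5 h6
  rw [h3, h4]
  by_cases hx : x ∈ {x | ‖φ x‖ ≤ t}
  · simp [Set.indicator_of_mem hx]
  · have hx' : t < ‖φ x‖ := not_le.1 hx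
    obtain ⟨n, hn⟩ := exists_nat_one_div_lt (sub_pos.2 hx')
    have h7 := h5 n
    have hxF : x ∈ {x | t + 1 / ((n : ℝ) + 1) ≤ ‖φ x‖} := by
      change t + 1 / ((n : ℝ) + 1) ≤ ‖φ x‖
      linarith
    rw [h6 n, Set.indicator_of_mem hxF, one_mul] at h7
    rw [h7, mul_zero]

/-- The range of the projection is invariant under both `T` and `T*`, so the projection commutes
with `T`. -/
theorem mulOp_sublevel_mem (hPM : P ≤ crossedProduct G μ)
    {φ : X → ℂ} (hφm : Measurable φ) (hφ : MemLp φ 2 μ) (ha : sgl 1 (hφ.toLp φ) ∈ traceSpace P)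
    {t : ℝ} (ht : 0 ≤ t) (hN : MeasurableSet {x | ‖φ x‖ ≤ t}) : mulOp G (indTop hN) ∈ P := by
  refine mem_vonNeumannAlgebra_of_commute fun T hT => ?_
  have h1 := commutant_range_invariant hPM hT hφm hφ ha ht hN
  have h2 := congrArg star (commutant_range_invariant hPM (star_mem hT) hφm hφ ha ht hN)
  rw [star_mul, star_mul, star_mulOp, star_star, star_indTop] at h2
  rw [← h1, ← h2, mul_assoc]

end Spectral

/-! ### Measurability tested on discs, and indicators in `L²`. -/

section Indicators

variable {X : Type u} [m₀ : MeasurableSpace X]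

theorem measurable_of_measurableSet_norm_sub_le {m : MeasurableSpace X} {φ : X → ℂ}
    (h : ∀ (c : ℂ) (t : ℝ), 0 ≤ t → MeasurableSet[m] {x | ‖φ x - c‖ ≤ t}) : Measurable[m] φ := by
  have hn (c : ℂ) : Measurable fun x => ‖φ x - c‖ := by
    refine measurable_of_Iic fun t => ?_
    by_cases ht : 0 ≤ t
    · exact h c t ht
    · convert! MeasurableSet.empty using 1
      ext x
      simp only [Set.mem_preimage, Set.mem_Iic, Set.mem_empty_iff_false, iff_false, not_le]
      exact (not_le.1 ht).trans_le (norm_nonneg _)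
  -- Polarization: `|z + 1|² - |z - 1|² = 4 Re z`, and likewise with `i` for the imaginary part.
  have hre : Measurable fun x => (φ x).re := by
    convert! (((hn (-1)).pow_const 2).sub ((hn 1).pow_const 2)).div_const 4 using 2 with x
    simp only [Pi.sub_apply, ← Complex.normSq_eq_norm_sq, Complex.normSq_apply]
    simp
    ring
  have him : Measurable fun x => (φ x).im := by
    convert! (((hn (-Complex.I)).pow_const 2).sub ((hn Complex.I).pow_const 2)).div_const 4
      using 2 with x
    simp only [Pi.sub_apply, ← Complex.normSq_eq_norm_sq, Complex.normSq_apply]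
    simp
    ring
  have : φ = fun x => ((φ x).re : ℂ) + ((φ x).im : ℂ) * Complex.I := by
    funext x; exact (Complex.re_add_im (φ x)).symm
  rw [this]
  exact (Complex.measurable_ofReal.comp hre).add ((Complex.measurable_ofReal.comp him).mul_const _)

variable {μ : Measure X} [IsProbabilityMeasure μ]

variable (μ) in
/-- The indicator function of a measurable set as an element of `L²`. -/
noncomputable def indL {E : Set X} (hE : MeasurableSet E) : Lp ℂ 2 μ :=
  indicatorConstLp 2 hE (measure_ne_top μ E) 1

theorem coeFn_indL {E : Set X} (hE : MeasurableSet E) :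
    indL μ hE =ᵐ[μ] E.indicator fun _ => (1 : ℂ) :=
  indicatorConstLp_coeFn

end Indicators

/-! ### Closed subspaces containing the indicators of a sub-σ-algebra. -/

section Induction

variable {X : Type u}

theorem mem_of_aestronglyMeasurable (m : MeasurableSpace X) [m₀ : MeasurableSpace X] {μ : Measure X}
    [IsProbabilityMeasure μ] (hm : m ≤ m₀)
    {V : Submodule ℂ (Lp ℂ 2 μ)} (hV : IsClosed (V : Set (Lp ℂ 2 μ)))
    (h : ∀ {E : Set X} (hE : MeasurableSet[m] E), indL μ (hm E hE) ∈ V) {ψ : Lp ℂ 2 μ}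
    (hψ : AEStronglyMeasurable[m] ψ μ) : ψ ∈ V := by
  refine Lp.induction_stronglyMeasurable hm ENNReal.ofNat_ne_top (· ∈ V) ?_ ?_ ?_ ψ hψ
  · intro c E hE hμ
    rw [Lp.simpleFunc.coe_indicatorConst]
    convert! V.smul_mem c (h hE) using 1
    apply Lp.ext
    filter_upwards [indicatorConstLp_coeFn (p := 2) (hs := hm E hE) (hμs := hμ.ne) (c := c),
      Lp.coeFn_smul c (indL μ (hm E hE)), coeFn_indL (μ := μ) (hm E hE)] with x h1 h2 h3
    rw [h1]
    refine Eq.trans ?_ h2.symm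
    rw [Pi.smul_apply, h3]
    by_cases hx : x ∈ E <;> simp [hx]
  · intro f g hf hg _ _ _ h1 h2
    exact V.add_mem h1 h2
  · exact hV.preimage continuous_subtype_val

end Induction

/-! ### The invariant σ-algebra attached to `P`. -/

section Sigma

variable {G : Type v} [Group G] {X : Type u} [MeasurableSpace X] {μ : Measure X}
  [MulAction G X] [MeasurableConstSMul G X] [SMulInvariantMeasure G X μ] [IsProbabilityMeasure μ]
  {P : VonNeumannAlgebra (CrossedSpace G μ)}

/-- The space of the functions `ψ ∈ L²(X)` such that `ψ ⊗ δ_e` belongs to `L²(P)`. -/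
noncomputable def baseSpace (P : VonNeumannAlgebra (CrossedSpace G μ)) :
    Submodule ℂ (Lp ℂ 2 μ) :=
  (traceSpace P).comap (sgl (1 : G)).toLinearMap

theorem mem_baseSpace {ψ : Lp ℂ 2 μ} : ψ ∈ baseSpace P ↔ sgl 1 ψ ∈ traceSpace P := Iff.rfl

theorem isClosed_baseSpace : IsClosed (baseSpace P : Set (Lp ℂ 2 μ)) :=
  isClosed_traceSpace.preimage (sgl (1 : G)).continuous

theorem oneL_mem_baseSpace : oneL μ ∈ baseSpace P :=
  apply_traceVector_mem (one_mem P)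

theorem mulOp_mem_iff_baseSpace (hPM : P ≤ crossedProduct G μ) (f : Lp ℂ ∞ μ) :
    mulOp G f ∈ P ↔ mulL f (oneL μ) ∈ baseSpace P :=
  mulOp_mem_iff hPM f

/-- Left multiplication by `u_g` followed by the right translation that returns to the coordinate
`e` is conjugation by `u_g`. -/
theorem koopman_mem_baseSpace (hGP : groupAlgebra G μ ≤ P) (hPM : P ≤ crossedProduct G μ) (g : G)
    {ψ : Lp ℂ 2 μ} (hψ : ψ ∈ baseSpace P) : koopman μ 2 g ψ ∈ baseSpace P := by
  have := apply_mem_traceSpace (hGP (unitaryOp_mem_groupAlgebra g))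
    (rightTranslation_mem hGP hPM g⁻¹ (mem_baseSpace.1 hψ))
  rwa [rightTranslation_sgl, unitaryOp_sgl, one_mul, mul_inv_cancel] at this

theorem indL_inter_mem (hPM : P ≤ crossedProduct G μ) {E F : Set X} (hE : MeasurableSet E)
    (hF : MeasurableSet F) (h1 : indL μ hE ∈ baseSpace P) (h2 : indL μ hF ∈ baseSpace P) :
    indL μ (hE.inter hF) ∈ baseSpace P := by
  rw [indL, ← mulL_indTop_oneL, ← mulOp_mem_iff_baseSpace hPM] at h1 h2 ⊢
  rw [← mulOp_mul (f := indTop hE) (h := indTop hF)]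
  · exact mul_mem h1 h2
  · filter_upwards [coeFn_indTop (μ := μ) hE, coeFn_indTop (μ := μ) hF,
      coeFn_indTop (μ := μ) (hE.inter hF)] with x h3 h4 h5
    rw [h3, h4, h5]
    by_cases hx : x ∈ E <;> by_cases hx' : x ∈ F <;> simp [hx, hx']

theorem indL_compl_mem {E : Set X} (hE : MeasurableSet E) (h1 : indL μ hE ∈ baseSpace P) :
    indL μ hE.compl ∈ baseSpace P := by
  have : indL μ hE.compl = oneL μ - indL μ hE := by
    apply Lp.ext
    filter_upwards [coeFn_indL (μ := μ) hE, coeFn_indL (μ := μ) hE.compl, coeFn_oneL (μ := μ),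
      Lp.coeFn_sub (oneL μ) (indL μ hE)] with x h3 h4 h5 h6
    rw [h6, Pi.sub_apply, h3, h4, h5]
    by_cases hx : x ∈ E <;> simp [hx]
  rw [this]
  exact sub_mem oneL_mem_baseSpace h1

theorem indL_union_mem (hPM : P ≤ crossedProduct G μ) {E F : Set X} (hE : MeasurableSet E)
    (hF : MeasurableSet F) (h1 : indL μ hE ∈ baseSpace P) (h2 : indL μ hF ∈ baseSpace P) :
    indL μ (hE.union hF) ∈ baseSpace P := by
  have := indL_compl_mem _ (indL_inter_mem hPM hE.compl hF.compl (indL_compl_mem hE h1)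
    (indL_compl_mem hF h2))
  convert! this using 2
  simp [Set.compl_inter]

/-- The finite unions converge in measure, hence their indicators converge in `L²`, and `baseSpace
P` is closed. -/
theorem indL_iUnion_mem (hPM : P ≤ crossedProduct G μ) {E : ℕ → Set X}
    (hE : ∀ n, MeasurableSet (E n)) (h : ∀ n, indL μ (hE n) ∈ baseSpace P) :
    indL μ (MeasurableSet.iUnion hE) ∈ baseSpace P := by
  have hA (n : ℕ) : MeasurableSet (Set.accumulate E n) := by
    rw [Set.accumulate_def]; exact MeasurableSet.biUnion (Set.to_countable _) fun i _ => hE i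
  have hmem (n : ℕ) : indL μ (hA n) ∈ baseSpace P := by
    induction n with
    | zero =>
      convert! h 0 using 2
      simp
    | succ n ih =>
      convert! indL_union_mem hPM (hA n) (hE (n + 1)) ih (h (n + 1)) using 2
      exact Set.accumulate_succ E n
  refine isClosed_baseSpace.mem_of_tendsto (f := fun n => indL μ (hA n)) (b := Filter.atTop) ?_
    (Filter.Eventually.of_forall hmem)
  refine tendsto_indicatorConstLp_set ENNReal.ofNat_ne_top ?_
  have hsub (n : ℕ) : Set.accumulate E n ⊆ ⋃ i, E i := Set.accumulate_subset_iUnion n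
  have heq (n : ℕ) : μ (symmDiff (Set.accumulate E n) (⋃ i, E i)) =
      μ (⋃ i, E i) - μ (Set.accumulate E n) := by
    rw [symmDiff_of_le (hsub n)]
    exact measure_sdiff (hsub n) (hA n).nullMeasurableSet (measure_ne_top _ _)
  simp_rw [heq]
  have := ENNReal.Tendsto.sub (tendsto_const_nhds (x := μ (⋃ i, E i)) (f := Filter.atTop))
    (tendsto_measure_iUnion_accumulate (μ := μ) (f := E)) (Or.inl (measure_ne_top _ _))
  rwa [tsub_self] at this

/-- The σ-algebra of the measurable sets whose indicator functions belong to `P`. -/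
@[reducible]
def factorSigma (hPM : P ≤ crossedProduct G μ) : MeasurableSpace X where
  MeasurableSet' E := ∃ hE : MeasurableSet E, indL μ hE ∈ baseSpace P
  measurableSet_empty := ⟨MeasurableSet.empty, by
    rw [indL, indicatorConstLp_empty]; exact zero_mem _⟩
  measurableSet_compl _ h := ⟨h.1.compl, indL_compl_mem h.1 h.2⟩
  measurableSet_iUnion _ h :=
    ⟨MeasurableSet.iUnion fun n => (h n).1, indL_iUnion_mem hPM (fun n => (h n).1) fun n => (h n).2⟩

theorem factorSigma_le (hPM : P ≤ crossedProduct G μ) :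
    factorSigma hPM ≤ (inferInstance : MeasurableSpace X) := fun _ h => h.1

/-- Constants lie in `baseSpace P`, so the sublevel result applies to every `ψ - c`, and discs
determine measurability. -/
theorem aestronglyMeasurable_of_mem_baseSpace (hPM : P ≤ crossedProduct G μ) {ψ : Lp ℂ 2 μ}
    (hψ : ψ ∈ baseSpace P) : AEStronglyMeasurable[factorSigma hPM] ψ μ := by
  have hm : Measurable ψ := (Lp.stronglyMeasurable ψ).measurable
  have : Measurable[factorSigma hPM] ψ := by
    refine measurable_of_measurableSet_norm_sub_le fun c t ht => ?_
    have hφm : Measurable fun x => ψ x - c := hm.sub_const c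
    have hc : MemLp (fun _ : X => c) 2 μ := memLp_const c
    have hφ : MemLp (fun x => ψ x - c) 2 μ := (Lp.memLp ψ).sub hc
    have hN : MeasurableSet {x | ‖ψ x - c‖ ≤ t} := measurableSet_le hφm.norm measurable_const
    have ha : hφ.toLp _ = ψ - c • oneL μ := by
      apply Lp.ext
      filter_upwards [hφ.coeFn_toLp, Lp.coeFn_sub ψ (c • oneL μ), Lp.coeFn_smul c (oneL μ),
        coeFn_oneL (μ := μ)] with x h1 h2 h3 h4
      rw [h1, h2, Pi.sub_apply, h3, Pi.smul_apply, h4, smul_eq_mul, mul_one]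
    refine ⟨hN, ?_⟩
    rw [indL, ← mulL_indTop_oneL, ← mulOp_mem_iff_baseSpace hPM]
    refine mulOp_sublevel_mem hPM hφm hφ ?_ ht hN
    rw [ha]
    exact mem_baseSpace.1 (sub_mem hψ (Submodule.smul_mem _ c oneL_mem_baseSpace))
  exact this.aestronglyMeasurable

open scoped Pointwise in
theorem measurableSet_smul_factorSigma (hGP : groupAlgebra G μ ≤ P)
    (hPM : P ≤ crossedProduct G μ) (g : G) {E : Set X} (h : MeasurableSet[factorSigma hPM] E) :
    MeasurableSet[factorSigma hPM] (g • E) := by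
  obtain ⟨hE, hE'⟩ := h
  refine ⟨hE.const_smul g, ?_⟩
  convert! koopman_mem_baseSpace hGP hPM g hE' using 1
  apply Lp.ext
  filter_upwards [coeFn_indL (μ := μ) (hE.const_smul g), coeFn_koopman g (indL μ hE),
    ae_smul g⁻¹ (coeFn_indL (μ := μ) hE)] with x h1 h2 h3
  rw [h1, h2, h3]
  by_cases hx : g⁻¹ • x ∈ E
  · rw [Set.indicator_of_mem hx, Set.indicator_of_mem (Set.mem_smul_set_iff_inv_smul_mem.2 hx)]
  · rw [Set.indicator_of_notMem hx,
      Set.indicator_of_notMem (mt Set.mem_smul_set_iff_inv_smul_mem.1 hx)]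

end Sigma

/-! ### Comparing `P` with the crossed product of a factor. -/

section Factor

variable {G : Type v} [Group G] {X : Type u} [MeasurableSpace X] {μ : Measure X}
  [MulAction G X] [MeasurableConstSMul G X] [SMulInvariantMeasure G X μ] [IsProbabilityMeasure μ]
  {P : VonNeumannAlgebra (CrossedSpace G μ)} {H : Subgroup G}

theorem GFactor.crossedProduct_le (F : GFactor G μ) :
    F.crossedProduct ≤ IntermediateCrossedProduct.crossedProduct G μ := by
  refine vonNeumannClosure_le ?_
  rintro _ (⟨f, rfl⟩ | ⟨s, rfl⟩)
  · exact mulOp_mem_crossedProduct _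
  · exact subset_vonNeumannClosure (Or.inr ⟨s, rfl⟩)

theorem GFactor.groupAlgebra_le (F : GFactor G μ) : groupAlgebra G μ ≤ F.crossedProduct := by
  refine vonNeumannClosure_le ?_
  rintro _ ⟨s, rfl⟩
  exact subset_vonNeumannClosure (Or.inr ⟨s, rfl⟩)

theorem GFactor.indL_mem_baseSpace (F : GFactor G μ) {E : Set F.Y} (hE : MeasurableSet E) :
    indL μ (F.measurePreserving.measurable hE) ∈ baseSpace F.crossedProduct := by
  rw [indL, ← mulL_indTop_oneL, ← mulOp_mem_iff_baseSpace F.crossedProduct_le]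
  have h1 : mulOp G (Lp.compMeasurePreserving F.π F.measurePreserving (indTop hE)) ∈
      F.crossedProduct := subset_vonNeumannClosure (Or.inl ⟨indTop hE, rfl⟩)
  have h2 : Lp.compMeasurePreserving F.π F.measurePreserving (indTop hE) =
      indTop (F.measurePreserving.measurable hE) := by
    apply Lp.ext
    filter_upwards [Lp.coeFn_compMeasurePreserving (indTop hE) F.measurePreserving,
      F.measurePreserving.quasiMeasurePreserving.ae (coeFn_indTop hE),
      coeFn_indTop (μ := μ) (F.measurePreserving.measurable hE)] with x h3 h4 h5
    rw [h3, h5, Function.comp_apply, h4]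
    rfl
  rwa [h2] at h1

theorem GFactor.crossedProduct_le_of_measurableSet (F : GFactor G μ)
    (hGP : groupAlgebra G μ ≤ P) (hPM : P ≤ IntermediateCrossedProduct.crossedProduct G μ)
    (h : ∀ E : Set F.Y, MeasurableSet E → MeasurableSet[factorSigma hPM] (F.π ⁻¹' E)) :
    F.crossedProduct ≤ P := by
  refine vonNeumannClosure_le ?_
  rintro _ (⟨f, rfl⟩ | ⟨s, rfl⟩)
  · refine (mulOp_mem_iff_baseSpace hPM _).2 ?_
    refine mem_of_aestronglyMeasurable (MeasurableSpace.comap F.π inferInstance)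
      F.measurePreserving.measurable.comap_le isClosed_baseSpace ?_ ?_
    · rintro _ ⟨E, hE, rfl⟩
      exact (h E hE).2
    · refine AEStronglyMeasurable.congr (f := f ∘ F.π) ?_ ?_
      · exact ((Lp.stronglyMeasurable f).comp_measurable
          (comap_measurable F.π)).aestronglyMeasurable
      · exact (Lp.coeFn_compMeasurePreserving f F.measurePreserving).symm.trans
          (coeFn_mulL_oneL _).symm
  · exact hGP (unitaryOp_mem_groupAlgebra s)

/-- The coordinates of `pΩ` lie in `baseSpace P`, hence are limits of simple functions over
`factorSigma`. The hypothesis puts them in `baseSpace F.crossedProduct`; right translations and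
summation recover `pΩ`. -/
theorem GFactor.le_crossedProduct (F : GFactor G μ) (hH : IsStronglyRelativelyICC H)
    (htriv : ∀ h ∈ H, ∀ᵐ x ∂μ, h • x = x) (hGP : groupAlgebra G μ ≤ P)
    (hPM : P ≤ IntermediateCrossedProduct.crossedProduct G μ)
    (h : ∀ {E : Set X} (hE : MeasurableSet E), indL μ hE ∈ baseSpace P →
      indL μ hE ∈ baseSpace F.crossedProduct) :
    P ≤ F.crossedProduct := by
  intro p hp
  refine mem_of_apply_traceVector_mem F.crossedProduct_le (hPM hp) ?_
  refine isClosed_traceSpace.mem_of_tendsto (hasSum_sgl (p (traceVector G μ)))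
    (Filter.Eventually.of_forall fun s => sum_mem fun g _ => ?_)
  have h1 : p (traceVector G μ) g ∈ baseSpace P :=
    sgl_mem_traceSpace hH htriv hGP hPM (apply_traceVector_mem hp) g
  generalize p (traceVector G μ) g = ψ at h1
  have h2 : ψ ∈ baseSpace F.crossedProduct :=
    mem_of_aestronglyMeasurable (factorSigma hPM) (factorSigma_le hPM) isClosed_baseSpace
      (fun hE => h hE.1 hE.2) (aestronglyMeasurable_of_mem_baseSpace hPM h1)
  have h3 := rightTranslation_mem F.groupAlgebra_le F.crossedProduct_le g (mem_baseSpace.1 h2)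
  rwa [rightTranslation_sgl, one_mul] at h3

end Factor

/-! ### Realising the σ-algebra by a point map. -/

section SetFactor

open scoped Pointwise

variable {G : Type v} [Group G] {X : Type u} [MeasurableSpace X] (μ : Measure X)
  [MulAction G X] [MeasurableConstSMul G X] [SMulInvariantMeasure G X μ] [IsProbabilityMeasure μ]

/-- The map sending a point to the family of the sets of `I` containing it. -/
def setMap (I : SubMulAction G (Set X)) (x : X) : I → Prop := fun E => x ∈ (E : Set X)

theorem measurable_setMap {m : MeasurableSpace X} {I : SubMulAction G (Set X)}
    (hI : ∀ E ∈ I, MeasurableSet[m] E) : Measurable (setMap I) :=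
  measurable_pi_iff.2 fun E => measurable_mem.2 (hI E E.2)

/-- The family is invariant as a family of sets, not just modulo null sets, so equivariance holds at
every point. -/
theorem setMap_smul (I : SubMulAction G (Set X)) (g : G) (x : X) (E : I) :
    setMap I (g • x) E = setMap I x (g⁻¹ • E) := by
  simp only [setMap, SubMulAction.val_smul, Set.mem_inv_smul_set_iff]

/-- The `G`-factor of `X` generated by a `G`-invariant family of measurable sets. -/
noncomputable def setFactor (I : SubMulAction G (Set X)) (hI : ∀ E ∈ I, MeasurableSet E) :
    GFactor G μ :=
  letI : MulAction G (I → Prop) := arrowAction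
  have hms : MeasurableConstSMul G (I → Prop) :=
    ⟨fun g => measurable_pi_iff.2 fun E => measurable_pi_apply (g⁻¹ • E)⟩
  have heq : ∀ (g : G) (x : X), setMap I (g • x) = g • setMap I x :=
    fun g x => funext fun E => setMap_smul I g x E
  have hmeas : Measurable (setMap I) := measurable_setMap hI
  { Y := I → Prop
    ν := μ.map (setMap I)
    isProbabilityMeasure := Measure.isProbabilityMeasure_map hmeas.aemeasurable
    smulInvariantMeasure := ⟨fun g s hs => by
      rw [Measure.map_apply hmeas hs, Measure.map_apply hmeas (hms.measurable_const_smul g hs)]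
      rw [← measure_preimage_smul μ g (setMap I ⁻¹' s)]
      congr 1
      ext x
      simp only [Set.mem_preimage, heq]⟩
    π := setMap I
    measurePreserving := ⟨hmeas, rfl⟩
    equivariant := heq }

theorem setFactor_standardBorelSpace (I : SubMulAction G (Set X))
    (hI : ∀ E ∈ I, MeasurableSet E) [Countable I] : StandardBorelSpace (setFactor μ I hI).Y :=
  inferInstanceAs (StandardBorelSpace (I → Prop))

theorem exists_measurableSet_setFactor (I : SubMulAction G (Set X))
    (hI : ∀ E ∈ I, MeasurableSet E) {E : Set X} (hE : E ∈ I) :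
    ∃ E' : Set (setFactor μ I hI).Y, MeasurableSet E' ∧ (setFactor μ I hI).π ⁻¹' E' = E := by
  refine ⟨{φ : I → Prop | φ ⟨E, hE⟩}, ?_, rfl⟩
  exact measurableSet_setOfPred.2 (measurable_pi_apply (⟨E, hE⟩ : I))

variable {μ} {P : VonNeumannAlgebra (CrossedSpace G μ)} {H : Subgroup G}

/-- `I` need not generate `factorSigma`: `L²`-density of its indicators suffices, because
`baseSpace` is closed. -/
theorem eq_setFactor_crossedProduct (hH : IsStronglyRelativelyICC H)
    (htriv : ∀ h ∈ H, ∀ᵐ x ∂μ, h • x = x) (hGP : groupAlgebra G μ ≤ P)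
    (hPM : P ≤ crossedProduct G μ) (I : SubMulAction G (Set X))
    (hI : ∀ E ∈ I, MeasurableSet[factorSigma hPM] E)
    (hdense : ∀ {E : Set X} (hE : MeasurableSet[factorSigma hPM] E), indL μ hE.1 ∈
      closure {ψ | ∃ (E' : Set X) (hE' : E' ∈ I), ψ = indL μ (hI E' hE').1}) :
    P = (setFactor μ I fun E hE => (hI E hE).1).crossedProduct := by
  refine le_antisymm (GFactor.le_crossedProduct _ hH htriv hGP hPM fun hE h => ?_)
    (GFactor.crossedProduct_le_of_measurableSet _ hGP hPM fun E hE => ?_)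
  · refine closure_minimal ?_ isClosed_baseSpace (hdense ⟨hE, h⟩)
    rintro _ ⟨E', hE', rfl⟩
    obtain ⟨E'', hm, he⟩ := exists_measurableSet_setFactor μ I (fun E hE => (hI E hE).1) hE'
    have := GFactor.indL_mem_baseSpace _ hm
    convert! this using 2
    exact he.symm
  · exact measurable_setMap hI hE

/-- The `G`-invariant family of the measurable sets whose indicator functions belong to `P`. -/
def factorSets (hGP : groupAlgebra G μ ≤ P) (hPM : P ≤ crossedProduct G μ) :
    SubMulAction G (Set X) where
  carrier := {E | MeasurableSet[factorSigma hPM] E}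
  smul_mem' g _ hE := measurableSet_smul_factorSigma hGP hPM g hE

/-- The `G`-invariant family generated by a family of sets. -/
def orbitFamily (G : Type v) [Group G] [MulAction G X] (D : Set (Set X)) :
    SubMulAction G (Set X) where
  carrier := Set.range fun q : G × D => q.1 • (q.2 : Set X)
  smul_mem' := by
    rintro g _ ⟨⟨k, E⟩, rfl⟩
    exact ⟨⟨g * k, E⟩, mul_smul g k (E : Set X)⟩

/-- `L²` of a standard Borel probability space is a separable metric space, so its subset of
indicators is separable too. -/
theorem exists_countable_dense_sets [StandardBorelSpace X] (hPM : P ≤ crossedProduct G μ) :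
    ∃ (D : Set (Set X)) (hD : ∀ E ∈ D, MeasurableSet[factorSigma hPM] E), D.Countable ∧
      ∀ {E : Set X} (hE : MeasurableSet[factorSigma hPM] E), indL μ hE.1 ∈
        closure {ψ | ∃ (E' : Set X) (hE' : E' ∈ D), ψ = indL μ (hD E' hE').1} := by
  have : Fact ((2 : ℝ≥0∞) ≠ ∞) := ⟨ENNReal.ofNat_ne_top⟩
  let ι : {E : Set X // MeasurableSet[factorSigma hPM] E} → Lp ℂ 2 μ := fun E => indL μ E.2.1
  obtain ⟨D, hDs, hDc, hD⟩ := (TopologicalSpace.IsSeparable.of_separableSpace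
    (Set.range ι)).exists_countable_dense_subset
  have hch (ψ : D) : ∃ E, ι E = ψ := hDs ψ.2
  choose s hs using hch
  have : Countable D := hDc.to_subtype
  refine ⟨Set.range fun ψ => (s ψ : Set X), ?_, Set.countable_range _, fun {E} hE => ?_⟩
  · rintro _ ⟨ψ, rfl⟩
    exact (s ψ).2
  · refine closure_mono ?_ (hD ⟨⟨E, hE⟩, rfl⟩)
    intro ψ hψ
    exact ⟨s ⟨ψ, hψ⟩, ⟨_, rfl⟩, (hs ⟨ψ, hψ⟩).symm⟩

theorem exists_eq_factor_crossedProduct [Countable G] (hH : IsStronglyRelativelyICC H)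
    (htriv : ∀ h ∈ H, ∀ᵐ x ∂μ, h • x = x) (hGP : groupAlgebra G μ ≤ P)
    (hPM : P ≤ crossedProduct G μ) :
    ∃ F : GFactor G μ, (StandardBorelSpace X → StandardBorelSpace F.Y) ∧ P = F.crossedProduct := by
  by_cases hX : StandardBorelSpace X
  · obtain ⟨D, hD, hDc, hdense⟩ := exists_countable_dense_sets hPM
    have : Countable D := hDc.to_subtype
    have hI : ∀ E ∈ orbitFamily G D, MeasurableSet[factorSigma hPM] E := by
      rintro _ ⟨⟨g, E⟩, rfl⟩
      exact measurableSet_smul_factorSigma hGP hPM g (hD E E.2)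
    -- Countability of `G` keeps the invariant family countable, so that `Y` is a countable power of
    -- `Prop`, hence standard Borel.
    have : Countable (orbitFamily G D) := (Set.countable_range _).to_subtype
    refine ⟨setFactor μ (orbitFamily G D) fun E hE => (hI E hE).1,
      fun _ => setFactor_standardBorelSpace μ _ _,
      eq_setFactor_crossedProduct hH htriv hGP hPM _ hI fun hE => closure_mono ?_ (hdense hE)⟩
    rintro _ ⟨E', hE', rfl⟩
    exact ⟨E', ⟨⟨1, ⟨E', hE'⟩⟩, one_smul G E'⟩, rfl⟩
  · refine ⟨setFactor μ (factorSets hGP hPM) fun E hE => hE.1, fun h => absurd h hX,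
      eq_setFactor_crossedProduct hH htriv hGP hPM _ (fun E hE => hE)
        fun {E} hE => subset_closure ⟨E, hE, rfl⟩⟩

end SetFactor

end IntermediateCrossedProduct

theorem mainTheorem7 {G : Type v} [Group G] [Countable G]
    {X : Type u} [MeasurableSpace X] (μ : Measure X) [IsProbabilityMeasure μ]
    [MulAction G X] [MeasurableConstSMul G X] [ErgodicSMul G X μ]
    (H : Subgroup G) (hH : IntermediateCrossedProduct.IsStronglyRelativelyICC H)
    (htriv : ∀ h ∈ H, ∀ᵐ x ∂μ, h • x = x)
    (P : VonNeumannAlgebra (IntermediateCrossedProduct.CrossedSpace G μ))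
    (hGP : IntermediateCrossedProduct.groupAlgebra G μ ≤ P)
    (hPM : P ≤ IntermediateCrossedProduct.crossedProduct G μ) :
    ∃ F : IntermediateCrossedProduct.GFactor G μ,
      (StandardBorelSpace X → StandardBorelSpace F.Y) ∧ P = F.crossedProduct :=
  IntermediateCrossedProduct.exists_eq_factor_crossedProduct hH htriv hGP hPM
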